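/- Let $n\ge 3$ and let $$D=\{z\in\mathbb C^n : |z|<1,\ 2|z|^2<1+|z^\top z|^2\}$$ be the $n$-dimensional Cartan domain of type IV. For real $\lambda>n-1$ let $v_\lambda$ be the probability measure on $D$ with density proportional to $(1-2|z|^2+|z^\top z|^2)^{\lambda-n}$ with respect to Lebesgue measure. Let $\mathcal A^2_\lambda(D)$ be the closed subspace of $L^2(D,v_\lambda)$ consisting of the (classes of) holomorphic functions, and let $B_\lambda$ be the orthogonal projection of $L^2(D,v_\lambda)$ onto it. For $a\in L^\infty(D)$ let $T_a^{(\lambda)}f=B_\lambda(af)$ be the Toeplitz operator with symbol $a$ on $\mathcal A^2_\lambda(D)$. Identify $\mathrm{SO}(2)$ with the unit circle in $\mathbb C$ and let $\mathrm{SO}(n)\times\mathrm{SO}(2)$ act on $D$ by $(A,t)\cdot z=tAz$. For a subgroup $H\subseteq\mathrm{SO}(n)\times\mathrm{SO}(2)$ let $L^\infty(D)^H$ be the set of all $a\in L^\infty(D)$ such that $a\circ h^{-1}=a$ almost everywhere for every $h\in H$, and let $\mathcal T^{(\lambda)}(L^\infty(D)^H)$ be the unital Banach algebra generated by the operators $T_a^{(\lambda)}$,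 $a\in L^\infty(D)^H$, that is, the closure in operator norm of the unital algebra generated by them. Then, for every $n\ge3$ and every $\lambda>n-1$: 1. $\mathcal T^{(\lambda)}(L^\infty(D)^{\mathrm{SO}(n)\times\mathrm{SO}(2)})$ is a commutative $C^*$-algebra. 2. If $H$ is any one of the three subgroups $\mathrm{SO}(n-1)\times\mathrm{SO}(2)$, $\mathrm T_n\times\mathrm{SO}(2)$, $\{I_n\}\times\mathrm{SO}(2)$, then $\mathcal T^{(\lambda)}(L^\infty(D)^H)$ is a $C^*$-algebra that is not commutative. Here $\mathrm{SO}(n-1)$ is embedded in $\mathrm{SO}(n)$ as the upper left corner, and $\mathrm T_n\subset\mathrm{SO}(n)$ is the maximal torus of block diagonal matrices $\mathrm{diag}(R(\theta_1),\dots,R(\theta_{\lfloor n/2\rfloor}))$, $\theta_j\in\mathbb R$, with a trailing diagonal entry $1$ when $n$ is odd, where $R(\vartheta)=\begin{pmatrix}\cos\vartheta&\sin\vartheta\\-\sin\vartheta&\cos\vartheta\end{pmatrix}$. -/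

import Mathlib

open MeasureTheory Matrix
open scoped ENNReal

noncomputable section

namespace CartanIV

/-! ### The group `SO(n) × SO(2)` and its subgroups -/

/-- `SO(m)`. -/
abbrev SO (m : ℕ) : Type := Matrix.specialOrthogonalGroup (Fin m) ℝ

/-- `SO(n) × SO(2)`, with `SO(2)` identified with the unit circle of `ℂ`. -/
abbrev K (n : ℕ) : Type := SO n × Circle

/-- The matrix with upper left block `B`, lower right entry `1` and zeros elsewhere. -/
def cornerMatrix {m : ℕ} (B : Matrix (Fin m) (Fin m) ℝ) : Matrix (Fin (m + 1)) (Fin (m + 1)) ℝ :=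
  Matrix.reindex finSumFinEquiv finSumFinEquiv
    (Matrix.fromBlocks B 0 0 (1 : Matrix (Fin 1) (Fin 1) ℝ))

theorem mem_SO_iff {ι : Type*} [Fintype ι] [DecidableEq ι] {A : Matrix ι ι ℝ} :
    A ∈ Matrix.specialOrthogonalGroup ι ℝ ↔ A * Aᵀ = 1 ∧ A.det = 1 := by
  rw [Matrix.mem_specialOrthogonalGroup_iff, Matrix.mem_orthogonalGroup_iff]

theorem reindex_mul {ι κ : Type*} [Fintype ι] [Fintype κ] (e : ι ≃ κ) (A B : Matrix ι ι ℝ) :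
    Matrix.reindex e e (A * B) = Matrix.reindex e e A * Matrix.reindex e e B :=
  (Matrix.submatrix_mul_equiv A B e.symm e.symm e.symm).symm

theorem reindex_mem_SO {ι κ : Type*} [Fintype ι] [DecidableEq ι] [Fintype κ] [DecidableEq κ]
    (e : ι ≃ κ) {A : Matrix ι ι ℝ} (hA : A ∈ Matrix.specialOrthogonalGroup ι ℝ) :
    Matrix.reindex e e A ∈ Matrix.specialOrthogonalGroup κ ℝ := by
  rw [mem_SO_iff] at hA ⊢
  refine ⟨?_, by simpa using hA.2⟩
  rw [Matrix.transpose_reindex, ← reindex_mul, hA.1]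
  simp

theorem fromBlocks_mem_SO {ι κ : Type*} [Fintype ι] [DecidableEq ι] [Fintype κ] [DecidableEq κ]
    {A : Matrix ι ι ℝ} (hA : A ∈ Matrix.specialOrthogonalGroup ι ℝ) :
    Matrix.fromBlocks A 0 0 (1 : Matrix κ κ ℝ) ∈ Matrix.specialOrthogonalGroup (ι ⊕ κ) ℝ := by
  rw [mem_SO_iff] at hA ⊢
  refine ⟨?_, by simpa using hA.2⟩
  simp [Matrix.fromBlocks_transpose, Matrix.fromBlocks_multiply, hA.1]

theorem reindex_fromBlocks_mul {ι κ μ : Type*} [Fintype ι] [DecidableEq ι] [Fintype κ]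
    [DecidableEq κ] [Fintype μ] [DecidableEq μ] (e : ι ⊕ κ ≃ μ) (A B : Matrix ι ι ℝ) :
    Matrix.reindex e e (Matrix.fromBlocks (A * B) 0 0 (1 : Matrix κ κ ℝ)) =
      Matrix.reindex e e (Matrix.fromBlocks A 0 0 1) *
        Matrix.reindex e e (Matrix.fromBlocks B 0 0 1) := by
  rw [← reindex_mul]
  simp [Matrix.fromBlocks_multiply]

/-- The upper left corner embedding `SO(m) → SO(m + 1)`. -/
def cornerHom (m : ℕ) : SO m →* SO (m + 1) where
  toFun B := ⟨cornerMatrix B.1, reindex_mem_SO _ (fromBlocks_mem_SO B.2)⟩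
  map_one' := by
    apply Subtype.ext
    simp [cornerMatrix, Matrix.fromBlocks_one]
  map_mul' A B := Subtype.ext (reindex_fromBlocks_mul _ A.1 B.1)

/-- The rotation matrix `R(θ)`. -/
def rot (θ : ℝ) : Matrix (Fin 2) (Fin 2) ℝ :=
  !![Real.cos θ, Real.sin θ; -Real.sin θ, Real.cos θ]

theorem rot_mem (θ : ℝ) : rot θ * (rot θ)ᵀ = 1 ∧ (rot θ).det = 1 := by
  have h := Real.sin_sq_add_cos_sq θ
  constructor
  · ext i j
    fin_cases i <;> fin_cases j <;> simp [rot, Matrix.mul_apply, Fin.sum_univ_two] <;> linarith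
  · simp [rot, Matrix.det_fin_two]; linarith

theorem rot_add (θ φ : ℝ) : rot (θ + φ) = rot θ * rot φ := by
  ext i j
  fin_cases i <;> fin_cases j <;>
    simp [rot, Matrix.mul_apply, Fin.sum_univ_two, Real.cos_add, Real.sin_add] <;> ring

theorem rot_zero : rot 0 = 1 := by
  ext i j
  fin_cases i <;> fin_cases j <;> simp [rot]

/-- The indices of `Fin n` in consecutive pairs: `(a, j)` is the index `2 * j + a`, and for odd `n`
the last index stands alone. -/
def torusIndex (n : ℕ) : (Fin 2 × Fin (n / 2)) ⊕ Fin (n % 2) ≃ Fin n :=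
  ((((Equiv.prodComm _ _).trans finProdFinEquiv).sumCongr (Equiv.refl _)).trans
    finSumFinEquiv).trans (finCongr (Nat.div_add_mod' n 2))

/-- `diag(R(θ₁), R(θ₂), …)`, with a trailing `1` when `n` is odd. -/
def torusMatrix (n : ℕ) (θ : Fin (n / 2) → ℝ) : Matrix (Fin n) (Fin n) ℝ :=
  Matrix.reindex (torusIndex n) (torusIndex n)
    (Matrix.fromBlocks (Matrix.blockDiagonal fun j => rot (θ j)) 0 0 1)

theorem torusMatrix_mem (n : ℕ) (θ : Fin (n / 2) → ℝ) :
    torusMatrix n θ ∈ Matrix.specialOrthogonalGroup (Fin n) ℝ := by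
  refine reindex_mem_SO _ (fromBlocks_mem_SO (mem_SO_iff.2 ⟨?_, ?_⟩))
  · rw [Matrix.blockDiagonal_transpose, ← Matrix.blockDiagonal_mul]
    simp only [(rot_mem _).1]
    exact Matrix.blockDiagonal_one
  · simp [Matrix.det_blockDiagonal, (rot_mem _).2]

/-- The parametrization of the maximal torus `T_n` of `SO(n)`; its range is `T_n`. -/
def torusHom (n : ℕ) : Multiplicative (Fin (n / 2) → ℝ) →* SO n where
  toFun θ := ⟨torusMatrix n θ.toAdd, torusMatrix_mem n _⟩
  map_one' := by
    apply Subtype.ext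
    have : (Matrix.blockDiagonal fun _ : Fin (n / 2) => (1 : Matrix (Fin 2) (Fin 2) ℝ)) = 1 :=
      Matrix.blockDiagonal_one
    simp [torusMatrix, rot_zero, this, Matrix.fromBlocks_one]
  map_mul' θ φ := by
    apply Subtype.ext
    refine Eq.trans ?_ (reindex_fromBlocks_mul _ _ _)
    rw [← Matrix.blockDiagonal_mul]
    simp [torusMatrix, rot_add]

/-- `SO(n) × SO(2)`. -/
def subgroupSOn (n : ℕ) : Subgroup (K n) := ⊤

/-- `SO(n - 1) × SO(2)`, for `n ≥ 1`. -/
def subgroupCorner : (n : ℕ) → Subgroup (K n)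
  | 0 => ⊤
  | m + 1 => (cornerHom m).range.prod ⊤

/-- `T_n × SO(2)`. -/
def subgroupTorus (n : ℕ) : Subgroup (K n) := (torusHom n).range.prod ⊤

/-- `SO(2)`, that is `{1} × SO(2)`. -/
def subgroupCircle (n : ℕ) : Subgroup (K n) := (⊥ : Subgroup (SO n)).prod ⊤

/-- The action `(A, t) · z = t A z`. -/
def act {n : ℕ} (g : K n) (z : Fin n → ℂ) : Fin n → ℂ :=
  (g.2 : ℂ) • (g.1.1.map ((↑) : ℝ → ℂ) *ᵥ z)

/-! ### Holomorphic functions in `L²`: closedness -/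

theorem enorm_le_lintegral_circle {E : Type*} [NormedAddCommGroup E] [NormedSpace ℂ E]
    {U : Set E} (hU : IsOpen U) {f : E → ℂ} (hf : DifferentiableOn ℂ f U) {z w : E}
    (hw : ∀ c : ℂ, ‖c‖ ≤ 1 → z + c • w ∈ U) :
    ENNReal.ofReal (2 * Real.pi) * ‖f z‖ₑ ≤
      ∫⁻ θ in Set.Ioc 0 (2 * Real.pi), ‖f (z + Complex.exp (θ * Complex.I) • w)‖ₑ := by
  have h1 : DiffContOnCl ℂ (fun c : ℂ => f (z + c • w)) (Metric.ball 0 |1|) := by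
    apply DifferentiableOn.diffContOnCl
    rw [abs_one, closure_ball (0 : ℂ) one_ne_zero]
    intro c hc
    have hc' : z + c • w ∈ U := hw c (by simpa using hc)
    have h2 : DifferentiableAt ℂ f (z + c • w) := (hf _ hc').differentiableAt (hU.mem_nhds hc')
    have h3 : DifferentiableAt ℂ (fun c : ℂ => z + c • w) c := by fun_prop
    exact (h2.comp c h3).differentiableWithinAt
  have h2 := h1.circleAverage
  simp only [Real.circleAverage, zero_smul, add_zero] at h2
  rw [← h2, intervalIntegral.integral_of_le Real.two_pi_pos.le, enorm_smul]
  have h3 : ‖((2 * Real.pi)⁻¹ : ℝ)‖ₑ = (ENNReal.ofReal (2 * Real.pi))⁻¹ := by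
    rw [Real.enorm_of_nonneg (inv_nonneg.2 Real.two_pi_pos.le),
      ENNReal.ofReal_inv_of_pos Real.two_pi_pos]
  rw [h3, ← mul_assoc, ENNReal.mul_inv_cancel (by simp [Real.pi_pos]) ENNReal.ofReal_ne_top,
    one_mul]
  refine (enorm_integral_le_lintegral_enorm _).trans (le_of_eq ?_)
  simp [circleMap]

theorem measurePreserving_rot (n : ℕ) (θ : ℝ) :
    MeasurePreserving (fun w : Fin n → ℂ => Complex.exp (θ * Complex.I) • w) := by
  have h : MeasurePreserving (fun w : ℂ => Complex.exp (θ * Complex.I) * w) := by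
    have := (rotation (Circle.exp θ)).measurePreserving
    convert! this using 2
  exact volume_preserving_pi (fun _ : Fin n => h)

/-- Mean value inequality on a polydisc. -/
theorem volume_ball_mul_enorm_le {n : ℕ} {U : Set (Fin n → ℂ)} (hU : IsOpen U)
    {f : (Fin n → ℂ) → ℂ} (hf : DifferentiableOn ℂ f U) {z : Fin n → ℂ} {r : ℝ}
    (hz : Metric.closedBall z r ⊆ U) :
    volume (Metric.closedBall z r) * ‖f z‖ₑ ≤ ∫⁻ w in Metric.closedBall z r, ‖f w‖ₑ := by
  set B : Set (Fin n → ℂ) := Metric.closedBall 0 r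
  have hB : MeasurableSet B := Metric.isClosed_closedBall.measurableSet
  have hmem : ∀ w ∈ B, ∀ c : ℂ, ‖c‖ ≤ 1 → z + c • w ∈ U := by
    intro w hw c hc
    apply hz
    simp only [B, mem_closedBall_zero_iff] at hw
    rw [Metric.mem_closedBall, dist_eq_norm, add_sub_cancel_left, norm_smul]
    nlinarith [norm_nonneg w, norm_nonneg c]
  have hshift : ∀ g : (Fin n → ℂ) → ℝ≥0∞,
      ∫⁻ w in Metric.closedBall z r, g w = ∫⁻ w in B, g (z + w) := by
    intro g
    have := (measurePreserving_add_left (volume : Measure (Fin n → ℂ)) z).setLIntegral_comp_preimage_emb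
      (MeasurableEquiv.addLeft z).measurableEmbedding g (Metric.closedBall z r)
    rw [← this]
    congr 2
    ext w
    simp [B, dist_eq_norm]
  have hrot : ∀ θ : ℝ, ∫⁻ w in B, ‖f (z + Complex.exp (θ * Complex.I) • w)‖ₑ =
      ∫⁻ w in B, ‖f (z + w)‖ₑ := by
    intro θ
    have := (measurePreserving_rot n θ).setLIntegral_comp_preimage_emb
      ((Homeomorph.smulOfNeZero (Complex.exp (θ * Complex.I)) (Complex.exp_ne_zero _)).measurableEmbedding)
      (fun w => ‖f (z + w)‖ₑ) B
    rw [← this]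
    congr 2
    ext w
    simp [B, norm_smul, Complex.norm_exp_ofReal_mul_I]
  have hvol : volume (Metric.closedBall z r) = volume B := by
    have := hshift (fun _ => 1)
    simpa using this
  rw [hshift, hvol]
  have hpi : ENNReal.ofReal (2 * Real.pi) ≠ 0 := by simp [Real.pi_pos]
  have key : ENNReal.ofReal (2 * Real.pi) * (volume B * ‖f z‖ₑ) ≤
      ENNReal.ofReal (2 * Real.pi) * ∫⁻ w in B, ‖f (z + w)‖ₑ := by
    calc ENNReal.ofReal (2 * Real.pi) * (volume B * ‖f z‖ₑ)
        = ∫⁻ w in B, ENNReal.ofReal (2 * Real.pi) * ‖f z‖ₑ := by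
          rw [setLIntegral_const]; ring
      _ ≤ ∫⁻ w in B, ∫⁻ θ in Set.Ioc 0 (2 * Real.pi),
            ‖f (z + Complex.exp (θ * Complex.I) • w)‖ₑ :=
          setLIntegral_mono' hB fun w hw => enorm_le_lintegral_circle hU hf (hmem w hw)
      _ = ∫⁻ θ in Set.Ioc 0 (2 * Real.pi), ∫⁻ w in B,
            ‖f (z + Complex.exp (θ * Complex.I) • w)‖ₑ := by
          apply lintegral_lintegral_swap
          rw [Measure.prod_restrict]
          apply AEMeasurable.enorm
          refine ContinuousOn.aemeasurable ?_ (hB.prod measurableSet_Ioc)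
          refine hf.continuousOn.comp (t := U) (by fun_prop) ?_
          rintro ⟨w, θ⟩ hw
          exact hmem w hw.1 _ (by simp [Complex.norm_exp_ofReal_mul_I])
      _ = ENNReal.ofReal (2 * Real.pi) * ∫⁻ w in B, ‖f (z + w)‖ₑ := by
          simp only [hrot]
          rw [setLIntegral_const, Real.volume_Ioc, sub_zero, mul_comm]
  exact (ENNReal.mul_le_mul_iff_right hpi ENNReal.ofReal_ne_top).1 key

theorem norm_le_of_aeEq {n : ℕ} {U : Set (Fin n → ℂ)} (hU : IsOpen U)
    {v : Measure (Fin n → ℂ)} {z₀ : Fin n → ℂ} {R : ℝ} (hR : 0 < R) {ε : ℝ≥0∞} (hε : ε ≠ 0)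
    (hε' : ε ≠ ∞) (hsub : Metric.closedBall z₀ R ⊆ U)
    (hv : ε • volume.restrict (Metric.closedBall z₀ R) ≤ v) :
    ∃ C : ℝ, 0 ≤ C ∧ ∀ (h : (Fin n → ℂ) → ℂ) (F : Lp ℂ 2 v), DifferentiableOn ℂ h U →
      F =ᵐ[v] h → ∀ z ∈ Metric.closedBall z₀ (R / 2), ‖h z‖ ≤ C * ‖F‖ := by
  set c : ℝ≥0∞ := ε * volume (Metric.closedBall (0 : Fin n → ℂ) (R / 2)) with hc
  have hc0 : c ≠ 0 := mul_ne_zero hε (Metric.measure_closedBall_pos _ _ (half_pos hR)).ne'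
  have hct : c ≠ ∞ := ENNReal.mul_ne_top hε' measure_closedBall_lt_top.ne
  refine ⟨Real.sqrt (c.toReal⁻¹), Real.sqrt_nonneg _, ?_⟩
  intro h F hh hF z hz
  have hsub' : Metric.closedBall z (R / 2) ⊆ Metric.closedBall z₀ R := by
    apply Metric.closedBall_subset_closedBall'
    have := Metric.mem_closedBall.1 hz
    linarith
  have hF2 : ‖F‖ₑ ^ 2 = ∫⁻ w, ‖h w‖ₑ ^ 2 ∂v := by
    have := eLpNorm_nnreal_pow_eq_lintegral (f := F) (μ := v) (p := 2) two_ne_zero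
    rw [Lp.enorm_def]
    have h2 : ∫⁻ w, ‖F w‖ₑ ^ 2 ∂v = ∫⁻ w, ‖h w‖ₑ ^ 2 ∂v :=
      lintegral_congr_ae (by filter_upwards [hF] with w hw; rw [hw])
    rw [← h2]
    simpa using this
  have h1 : c * ‖h z‖ₑ ^ 2 ≤ ‖F‖ₑ ^ 2 := by
    calc c * ‖h z‖ₑ ^ 2
        = ε * (volume (Metric.closedBall z (R / 2)) * ‖h z ^ 2‖ₑ) := by
          rw [hc, Measure.addHaar_closedBall_center volume z, enorm_pow, mul_assoc]
      _ ≤ ε * ∫⁻ w in Metric.closedBall z (R / 2), ‖h w ^ 2‖ₑ := by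
          gcongr
          exact volume_ball_mul_enorm_le hU (hh.pow 2) (hsub'.trans hsub)
      _ ≤ ε * ∫⁻ w in Metric.closedBall z₀ R, ‖h w ^ 2‖ₑ := by
          gcongr
      _ = ∫⁻ w, ‖h w ^ 2‖ₑ ∂(ε • volume.restrict (Metric.closedBall z₀ R)) := by
          rw [lintegral_smul_measure, smul_eq_mul]
      _ ≤ ∫⁻ w, ‖h w ^ 2‖ₑ ∂v := lintegral_mono' hv le_rfl
      _ = ‖F‖ₑ ^ 2 := by
          rw [hF2]
          simp only [enorm_pow]
  have h2 : c.toReal * ‖h z‖ ^ 2 ≤ ‖F‖ ^ 2 := by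
    have := ENNReal.toReal_mono (by finiteness) h1
    simpa using this
  have hcp : 0 < c.toReal := ENNReal.toReal_pos hc0 hct
  apply le_of_sq_le_sq _ (by positivity)
  rw [mul_pow, Real.sq_sqrt (by positivity), inv_mul_eq_div, le_div_iff₀ hcp]
  linarith

theorem fderiv_norm_le {E : Type*} [NormedAddCommGroup E] [NormedSpace ℂ E] {f : E → ℂ} {z : E}
    {r M : ℝ} (hr : 0 < r) (hf : DifferentiableOn ℂ f (Metric.ball z r))
    (hM : ∀ w ∈ Metric.ball z r, ‖f w‖ ≤ M) : ‖fderiv ℂ f z‖ ≤ 2 * M / r := by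
  have hM0 : 0 ≤ M := (norm_nonneg _).trans (hM z (Metric.mem_ball_self hr))
  have key : ∀ δ : ℝ, 0 < δ → ‖fderiv ℂ f z‖ ≤ (2 * M + δ) / r := by
    intro δ hδ
    refine Complex.norm_fderiv_le_div_of_mapsTo_ball hf ?_ hr
    intro w hw
    rw [Metric.mem_closedBall, dist_eq_norm]
    have h1 := hM w hw
    have h2 := hM z (Metric.mem_ball_self hr)
    have h3 := norm_sub_le (f w) (f z)
    linarith
  apply le_of_forall_pos_le_add
  intro δ hδ
  have := key (δ * r) (by positivity)
  rw [add_div, mul_div_cancel_right₀ _ hr.ne'] at this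
  exact this

/-- The elements of `L²(v)` represented by a function holomorphic on `U`. -/
def holoL2 {n : ℕ} (U : Set (Fin n → ℂ)) (v : Measure (Fin n → ℂ)) : Submodule ℂ (Lp ℂ 2 v) where
  carrier := {F | ∃ h : (Fin n → ℂ) → ℂ, DifferentiableOn ℂ h U ∧ F =ᵐ[v] h}
  zero_mem' := ⟨fun _ => 0, differentiableOn_const _, Lp.coeFn_zero _ _ _⟩
  add_mem' := by
    rintro F G ⟨h, hh, hF⟩ ⟨k, hk, hG⟩
    exact ⟨h + k, hh.add hk, (Lp.coeFn_add F G).trans (hF.add hG)⟩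
  smul_mem' := by
    rintro c F ⟨h, hh, hF⟩
    exact ⟨c • h, hh.const_smul c, (Lp.coeFn_smul c F).trans (hF.const_smul c)⟩

theorem isClosed_holoL2 {n : ℕ} {U : Set (Fin n → ℂ)} (hU : IsOpen U)
    {v : Measure (Fin n → ℂ)} (hvU : v Uᶜ = 0)
    (hv : ∀ z₀ ∈ U, ∃ R : ℝ, 0 < R ∧ ∃ ε : ℝ≥0∞, ε ≠ 0 ∧ ε ≠ ∞ ∧ Metric.closedBall z₀ R ⊆ U ∧
      ε • volume.restrict (Metric.closedBall z₀ R) ≤ v) :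
    IsClosed (holoL2 U v : Set (Lp ℂ 2 v)) := by
  apply IsSeqClosed.isClosed
  intro F G hF hFG
  choose h hh hFh using hF
  have hest : ∀ z₀ ∈ U, ∃ R : ℝ, 0 < R ∧ Metric.closedBall z₀ R ⊆ U ∧ ∃ C : ℝ, 0 ≤ C ∧
      ∀ k l, ∀ z ∈ Metric.closedBall z₀ R, ‖h k z - h l z‖ ≤ C * ‖F k - F l‖ := by
    intro z₀ hz₀
    obtain ⟨R, hR, ε, hε, hε', hsub, hle⟩ := hv z₀ hz₀
    obtain ⟨C, hC, hCb⟩ := norm_le_of_aeEq hU hR hε hε' hsub hle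
    refine ⟨R / 2, half_pos hR,
      (Metric.closedBall_subset_closedBall (by linarith)).trans hsub, C, hC, ?_⟩
    intro k l z hz
    exact hCb (h k - h l) (F k - F l) ((hh k).sub (hh l))
      ((Lp.coeFn_sub _ _).trans ((hFh k).sub (hFh l))) z hz
  have hcau := hFG.cauchySeq
  -- pointwise limits of the representatives
  have hlim : ∀ z, ∃ y, z ∈ U → Filter.Tendsto (fun k => h k z) Filter.atTop (nhds y) := by
    intro z
    by_cases hz : z ∈ U
    · obtain ⟨R, hR, -, C, hC, hb⟩ := hest z hz
      have : CauchySeq fun k => h k z := by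
        rw [Metric.cauchySeq_iff] at hcau ⊢
        intro δ hδ
        obtain ⟨N, hN⟩ := hcau (δ / (C + 1)) (by positivity)
        refine ⟨N, fun k hk l hl => ?_⟩
        have h1 := hN k hk l hl
        rw [dist_eq_norm, lt_div_iff₀ (by positivity)] at h1
        rw [dist_eq_norm]
        have h2 := hb k l z (Metric.mem_closedBall_self hR.le)
        nlinarith [norm_nonneg (F k - F l)]
      obtain ⟨y, hy⟩ := cauchySeq_tendsto_of_complete this
      exact ⟨y, fun _ => hy⟩
    · exact ⟨0, fun h => absurd h hz⟩
  choose g hg using hlim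
  refine ⟨g, ?_, ?_⟩
  · intro z₀ hz₀
    obtain ⟨R, hR, hsub, C, hC, hb⟩ := hest z₀ hz₀
    have hsubU : Metric.ball z₀ (R / 2) ⊆ U :=
      (Metric.ball_subset_closedBall.trans
        (Metric.closedBall_subset_closedBall (by linarith))).trans hsub
    have hd : ∀ k, ∀ z ∈ U, DifferentiableAt ℂ (h k) z := fun k z hz =>
      (hh k z hz).differentiableAt (hU.mem_nhds hz)
    -- uniform Cauchy estimate for the derivatives
    have hfd : ∀ k l, ∀ z ∈ Metric.ball z₀ (R / 2),
        ‖fderiv ℂ (h k) z - fderiv ℂ (h l) z‖ ≤ 2 * (C * ‖F k - F l‖) / (R / 2) := by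
      intro k l z hz
      have hz2 : Metric.ball z (R / 2) ⊆ Metric.closedBall z₀ R := by
        refine Metric.ball_subset_closedBall.trans (Metric.closedBall_subset_closedBall' ?_)
        have := Metric.mem_ball.1 hz
        linarith
      rw [← fderiv_sub (hd k z (hsubU hz)) (hd l z (hsubU hz))]
      refine fderiv_norm_le (half_pos hR) ?_ ?_
      · exact ((hh k).sub (hh l)).mono (hz2.trans hsub)
      · intro w hw
        exact hb k l w (hz2 hw)
    have huc : UniformCauchySeqOn (fun k => fderiv ℂ (h k)) Filter.atTop
        (Metric.ball z₀ (R / 2)) := by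
      rw [Metric.uniformCauchySeqOn_iff]
      intro δ hδ
      rw [Metric.cauchySeq_iff] at hcau
      obtain ⟨N, hN⟩ := hcau (δ * (R / 2) / (2 * (C + 1))) (by positivity)
      refine ⟨N, fun k hk l hl z hz => ?_⟩
      have h1 := hN k hk l hl
      rw [dist_eq_norm, lt_div_iff₀ (by positivity)] at h1
      rw [dist_eq_norm]
      refine (hfd k l z hz).trans_lt ?_
      rw [div_lt_iff₀ (half_pos hR)]
      nlinarith [norm_nonneg (F k - F l)]
    have hlim' : ∀ z, ∃ y, z ∈ Metric.ball z₀ (R / 2) →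
        Filter.Tendsto (fun k => fderiv ℂ (h k) z) Filter.atTop (nhds y) := by
      intro z
      by_cases hz : z ∈ Metric.ball z₀ (R / 2)
      · obtain ⟨y, hy⟩ := cauchySeq_tendsto_of_complete (huc.cauchySeq hz)
        exact ⟨y, fun _ => hy⟩
      · exact ⟨0, fun h => absurd h hz⟩
    choose g' hg' using hlim'
    have htu : TendstoUniformlyOn (fun k => fderiv ℂ (h k)) g' Filter.atTop
        (Metric.ball z₀ (R / 2)) := huc.tendstoUniformlyOn_of_tendsto hg'
    have := hasFDerivAt_of_tendstoUniformlyOn Metric.isOpen_ball htu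
      (fun k z hz => (hd k z (hsubU hz)).hasFDerivAt) (fun z hz => hg z (hsubU hz))
      (Metric.mem_ball_self (half_pos hR))
    exact this.differentiableAt.differentiableWithinAt
  · obtain ⟨φ, hφ, hae⟩ := (tendstoInMeasure_of_tendsto_Lp hFG).exists_seq_tendsto_ae
    have hU' : ∀ᵐ z ∂v, z ∈ U := hvU
    filter_upwards [hae, ae_all_iff.2 hFh, hU'] with z hz1 hz2 hz3
    simp only [hz2] at hz1
    exact tendsto_nhds_unique hz1 ((hg z hz3).comp hφ.tendsto_atTop)

/-- The Cartan domain of type IV. -/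
def domain (n : ℕ) : Set (Fin n → ℂ) :=
  {z | ∑ i, ‖z i‖ ^ 2 < 1 ∧ 2 * ∑ i, ‖z i‖ ^ 2 < 1 + ‖z ⬝ᵥ z‖ ^ 2}

/-- `Δ(z) = 1 - 2|z|² + |zᵀz|²`. -/
def Delta {n : ℕ} (z : Fin n → ℂ) : ℝ := 1 - 2 * ∑ i, ‖z i‖ ^ 2 + ‖z ⬝ᵥ z‖ ^ 2

/-- `Δ(z)^(lam - n) dv(z)` on the domain, with unnormalized Lebesgue measure. -/
def weighted (n : ℕ) (lam : ℝ) : Measure (Fin n → ℂ) :=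
  (volume.restrict (domain n)).withDensity fun z => ENNReal.ofReal (Delta z ^ (lam - n))

/-- The weighted measure, normalized to total mass `1` (for `lam > n - 1` the total mass of
`weighted n lam` is positive and finite); normalizing Lebesgue measure beforehand makes no
difference. -/
def vMeasure (n : ℕ) (lam : ℝ) : Measure (Fin n → ℂ) :=
  (weighted n lam Set.univ)⁻¹ • weighted n lam

theorem isOpen_domain (n : ℕ) : IsOpen (domain n) := by
  simp only [domain, dotProduct]
  apply IsOpen.and
  · exact isOpen_lt (by fun_prop) (by fun_prop)
  · exact isOpen_lt (by fun_prop) (by fun_prop)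

theorem continuous_Delta (n : ℕ) : Continuous (Delta (n := n)) := by
  unfold Delta dotProduct
  fun_prop

theorem Delta_pos {n : ℕ} {z : Fin n → ℂ} (hz : z ∈ domain n) : 0 < Delta z := by
  have := hz.2
  unfold Delta
  linarith

theorem vMeasure_compl (n : ℕ) (lam : ℝ) : vMeasure n lam (domain n)ᶜ = 0 := by
  have h : weighted n lam ≪ volume.restrict (domain n) := withDensity_absolutelyContinuous _ _
  have h' : weighted n lam (domain n)ᶜ = 0 := by
    apply h
    rw [Measure.restrict_apply (isOpen_domain n).measurableSet.compl]
    simp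
  rw [vMeasure, Measure.smul_apply, h', smul_zero]

theorem isClosed_bergman (n : ℕ) (lam : ℝ) :
    IsClosed (holoL2 (domain n) (vMeasure n lam) : Set (Lp ℂ 2 (vMeasure n lam))) := by
  by_cases h0 : (weighted n lam Set.univ)⁻¹ = 0
  · have : vMeasure n lam = 0 := by rw [vMeasure, h0, zero_smul]
    have hz : ∀ F : Lp ℂ 2 (vMeasure n lam), F = 0 := by
      intro F
      apply Lp.ext
      have hae : ae (vMeasure n lam) = ⊥ := by rw [this, ae_zero]
      rw [Filter.EventuallyEq, Filter.Eventually, hae]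
      exact Filter.mem_bot
    have : (holoL2 (domain n) (vMeasure n lam) : Set (Lp ℂ 2 (vMeasure n lam))) = Set.univ := by
      ext F
      simp [hz F]
    rw [this]
    exact isClosed_univ
  refine isClosed_holoL2 (isOpen_domain n) (vMeasure_compl n lam) ?_
  intro z₀ hz₀
  obtain ⟨R, hR, hsub⟩ := Metric.nhds_basis_closedBall.mem_iff.1 ((isOpen_domain n).mem_nhds hz₀)
  have hcont : ContinuousOn (fun z : Fin n → ℂ => Delta z ^ (lam - n)) (Metric.closedBall z₀ R) :=
    fun z hz => ((continuous_Delta n).continuousAt.rpow_const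
      (Or.inl (Delta_pos (hsub hz)).ne')).continuousWithinAt
  obtain ⟨z₁, hz₁, hmin⟩ := (isCompact_closedBall z₀ R).exists_isMinOn
    ⟨z₀, Metric.mem_closedBall_self hR.le⟩ hcont
  set m : ℝ := Delta z₁ ^ (lam - n)
  have hm : 0 < m := Real.rpow_pos_of_pos (Delta_pos (hsub hz₁)) _
  set c : ℝ≥0∞ := min 1 (weighted n lam Set.univ)⁻¹
  have hc0 : c ≠ 0 := by
    simp only [c]
    rcases min_choice 1 (weighted n lam Set.univ)⁻¹ with h | h <;> rw [h]
    · exact one_ne_zero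
    · exact h0
  have hct : c ≠ ∞ := ne_top_of_le_ne_top ENNReal.one_ne_top (min_le_left _ _)
  refine ⟨R, hR, c * ENNReal.ofReal m, mul_ne_zero hc0 (by simpa using hm),
    ENNReal.mul_ne_top hct ENNReal.ofReal_ne_top, hsub, ?_⟩
  have h1 : ENNReal.ofReal m • volume.restrict (Metric.closedBall z₀ R) ≤ weighted n lam := by
    rw [Measure.le_iff]
    intro s hs
    rw [weighted, withDensity_apply _ hs, Measure.restrict_restrict hs, Measure.smul_apply,
      Measure.restrict_apply hs, smul_eq_mul]
    calc ENNReal.ofReal m * volume (s ∩ Metric.closedBall z₀ R)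
        = ∫⁻ z in s ∩ Metric.closedBall z₀ R, ENNReal.ofReal m := by rw [setLIntegral_const]
      _ ≤ ∫⁻ z in s ∩ Metric.closedBall z₀ R, ENNReal.ofReal (Delta z ^ (lam - n)) :=
          setLIntegral_mono' (hs.inter Metric.isClosed_closedBall.measurableSet)
            fun z hz => ENNReal.ofReal_le_ofReal (hmin hz.2)
      _ ≤ _ := lintegral_mono_set (Set.inter_subset_inter_right s hsub)
  rw [mul_smul, vMeasure]
  rw [Measure.le_iff] at h1 ⊢
  intro s hs
  rw [Measure.smul_apply, Measure.smul_apply]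
  exact mul_le_mul' (min_le_right _ _) (h1 s hs)

/-- The weighted Bergman space as a subspace of `L²`. -/
def bergman (n : ℕ) (lam : ℝ) : Submodule ℂ (Lp ℂ 2 (vMeasure n lam)) :=
  holoL2 (domain n) (vMeasure n lam)


/-- The weighted Bergman space as a Hilbert space. -/
def BergmanSpace (n : ℕ) (lam : ℝ) : Type := bergman n lam

instance (n : ℕ) (lam : ℝ) : NormedAddCommGroup (BergmanSpace n lam) :=
  inferInstanceAs (NormedAddCommGroup (bergman n lam))

instance (n : ℕ) (lam : ℝ) : InnerProductSpace ℂ (BergmanSpace n lam) :=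
  inferInstanceAs (InnerProductSpace ℂ (bergman n lam))

instance (n : ℕ) (lam : ℝ) : CompleteSpace (BergmanSpace n lam) :=
  (isClosed_bergman n lam).completeSpace_coe

/-- The inclusion of the Bergman space in `L²`. -/
def bergmanIncl (n : ℕ) (lam : ℝ) : BergmanSpace n lam →ₗᵢ[ℂ] Lp ℂ 2 (vMeasure n lam) :=
  (bergman n lam).subtypeₗᵢ

/-- The Bergman projection, the orthogonal projection of `L²` onto the Bergman space. -/
def bergmanProj (n : ℕ) (lam : ℝ) : Lp ℂ 2 (vMeasure n lam) →L[ℂ] BergmanSpace n lam :=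
  haveI : CompleteSpace (bergman n lam) := (isClosed_bergman n lam).completeSpace_coe
  (bergman n lam).orthogonalProjectionOnto

/-- The multiplication operator `M_a` on `L²`. -/
def mulOp (n : ℕ) (lam : ℝ) (a : Lp ℂ ∞ (vMeasure n lam)) :
    Lp ℂ 2 (vMeasure n lam) →L[ℂ] Lp ℂ 2 (vMeasure n lam) :=
  (ContinuousLinearMap.mul ℂ ℂ).holderL (vMeasure n lam) ∞ 2 2 a

/-- The Toeplitz operator `T_a = B ∘ M_a` on the Bergman space. -/
def toeplitz (n : ℕ) (lam : ℝ) (a : Lp ℂ ∞ (vMeasure n lam)) :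
    BergmanSpace n lam →L[ℂ] BergmanSpace n lam :=
  bergmanProj n lam ∘L mulOp n lam a ∘L (bergmanIncl n lam).toContinuousLinearMap

/-- The `H`-invariant symbols `L^∞(D)^H`: the classes `a` with `a ∘ h⁻¹ = a` almost everywhere
for every `h ∈ H`. -/
def invariantSymbols (n : ℕ) (lam : ℝ) (H : Subgroup (K n)) : Set (Lp ℂ ∞ (vMeasure n lam)) :=
  {a | ∀ h ∈ H, (fun z => a (act h⁻¹ z)) =ᵐ[vMeasure n lam] a}

/-- The unital Banach algebra generated by the Toeplitz operators with symbols in `S`: the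
operator-norm closure of the unital algebra they generate. -/
def toeplitzAlgebra (n : ℕ) (lam : ℝ) (S : Set (Lp ℂ ∞ (vMeasure n lam))) :
    Subalgebra ℂ (BergmanSpace n lam →L[ℂ] BergmanSpace n lam) :=
  (Algebra.adjoin ℂ (toeplitz n lam '' S)).topologicalClosure

/-- `B` is a (unital) C⋆-subalgebra of `A`: norm closed and closed under adjoints. -/
def IsCStarSubalgebra {A : Type*} [CStarAlgebra A] (B : Subalgebra ℂ A) : Prop :=
  IsClosed (B : Set A) ∧ ∀ T ∈ B, star T ∈ B

/-- Any two elements of `B` commute. -/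
def IsCommutativeSubalgebra {A : Type*} [CStarAlgebra A] (B : Subalgebra ℂ A) : Prop :=
  ∀ S ∈ B, ∀ T ∈ B, S * T = T * S

end CartanIV

end

noncomputable section

namespace CartanIV

/-! ### Finiteness of the weighted measure -/

/-! The C⋆ property holds for every `H`: the adjoint of `T_a` is the Toeplitz operator of the
conjugate symbol (`star_toeplitz`), conjugation preserves `H`-invariance, and the adjoint is norm
continuous.

Commutativity for the full group `K = SO(n) × SO(2)` is Gelfand's trick, with no decomposition into
irreducibles. Operators with invariant symbols commute with the unitary representation `f ↦ f ∘
g⁻¹`. Let `J f (z) = conj (f (conj z))`, an antiunitary involution, and let `k z` be the reproducing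
kernel. If `S` commutes with `K`, then `⟪k z, S (k z)⟫` is constant on `K`-orbits. For `n ≥ 3` the
points `z` and `conj z` share an orbit (`exists_act_eq_star`), so this function is invariant under
`z ↦ conj z`. Polarization, that is, the identity theorem in a complexified parameter, turns this
into `S = J S* J` (`eq_conj_adjoint`). Then `S T = J (S T)* J = (J T* J)(J S* J) = T S`.

For noncommutativity let `V` be the space `quadSpace` of holomorphic functions homogeneous of degree
two on which `H` acts by the character of `∑ z_i²`. It is finite-dimensional and invariant under all
`T_a` with `H`-invariant `a`. It has dimension at least two, because each of the three groups
preserves a proper partial sum of squares. If the `T_a` commuted, their restrictions to `V` would be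
reducible: there would be nonzero `f, h` in `V` with `⟪h, T_a f⟫ = 0` for all invariant `a`
(`exists_orthogonal_of_commute`). But `a = conj f * h` is bounded and invariant, and gives `∫ |f h|²
= 0`, so `f h = 0`, which is impossible for nonzero holomorphic functions on the domain
(`not_isCommutativeSubalgebra`).

All of this needs the total mass of the weight to be finite for `lam > n - 1`
(`weighted_univ_lt_top`). -/

theorem lintegral_rpow_Ioo_lt_top {s : ℝ} (hs : -1 < s) :
    ∫⁻ r in Set.Ioo (0 : ℝ) 1, ENNReal.ofReal (r ^ s) < ∞ := by
  have h : IntegrableOn (fun r : ℝ => r ^ s) (Set.Ioo 0 1) :=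
    ((intervalIntegrable_iff_integrableOn_Ioo_of_le zero_le_one).1
      (intervalIntegral.intervalIntegrable_rpow' hs))
  exact (hasFiniteIntegral_iff_ofReal (by
    filter_upwards [ae_restrict_mem measurableSet_Ioo] with r hr
    exact Real.rpow_nonneg hr.1.le _)).1 h.2

/-- The Jacobian `r` of polar coordinates absorbs the factor `(R + r) ^ s`, since `r (R + r) ^ s ≤
(R + r) ^ (1 + s)` and `1 + s > 0`. Only the boundary singularity `(R - r) ^ s` remains. -/
theorem mul_rpow_paraboloid_le {s p R r : ℝ} (hs : -1 < s) (hp : 0 < p) (hR : R ≤ 1) (hr : 0 < r)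
    (hrR : r < R) : r * (p * (R ^ 2 - r ^ 2)) ^ s ≤ (2 ^ (1 + s) * p ^ s) * (R - r) ^ s := by
  have h1 : p * (R ^ 2 - r ^ 2) = p * ((R - r) * (R + r)) := by ring
  rw [h1, Real.mul_rpow hp.le (mul_nonneg (by linarith) (by linarith)),
    Real.mul_rpow (by linarith) (by linarith)]
  have h2 : r * (R + r) ^ s ≤ 2 ^ (1 + s) := by
    calc r * (R + r) ^ s ≤ (R + r) * (R + r) ^ s := by
          gcongr
          · exact Real.rpow_nonneg (by linarith) _
          · linarith
      _ = (R + r) ^ (1 + s) := by rw [Real.rpow_add (by linarith), Real.rpow_one]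
      _ ≤ 2 ^ (1 + s) := Real.rpow_le_rpow (by linarith) (by linarith) (by linarith)
  calc r * (p ^ s * ((R - r) ^ s * (R + r) ^ s))
      = (r * (R + r) ^ s) * (p ^ s * (R - r) ^ s) := by ring
    _ ≤ 2 ^ (1 + s) * (p ^ s * (R - r) ^ s) := by
        have : 0 ≤ p ^ s * (R - r) ^ s :=
          mul_nonneg (Real.rpow_nonneg hp.le _) (Real.rpow_nonneg (by linarith) _)
        gcongr
    _ = _ := by ring

/-- Powers `> -1` of a concave paraboloid over a disc are integrable, uniformly in the
paraboloid. -/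
theorem exists_lintegral_paraboloid_le {s : ℝ} (hs : -1 < s) :
    ∃ C : ℝ≥0∞, C ≠ ∞ ∧ ∀ (c : ℂ) (p R : ℝ), 0 < p → R ≤ 1 →
      ∫⁻ ζ in Metric.ball c R, ENNReal.ofReal ((p * (R ^ 2 - ‖ζ - c‖ ^ 2)) ^ s) ≤
        C * ENNReal.ofReal (p ^ s) := by
  set I : ℝ≥0∞ := ∫⁻ r in Set.Ioo (0 : ℝ) 1, ENNReal.ofReal (r ^ s) with hI
  refine ⟨ENNReal.ofReal (2 * Real.pi) * ENNReal.ofReal (2 ^ (1 + s)) * I, ?_, ?_⟩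
  · exact ENNReal.mul_ne_top (ENNReal.mul_ne_top ENNReal.ofReal_ne_top ENNReal.ofReal_ne_top)
      (lintegral_rpow_Ioo_lt_top hs).ne
  intro c p R hp hR
  set F : ℝ → ℝ≥0∞ := (Set.Iio R).indicator fun r => ENNReal.ofReal ((p * (R ^ 2 - r ^ 2)) ^ s)
    with hF
  have h1 : ∫⁻ ζ in Metric.ball c R, ENNReal.ofReal ((p * (R ^ 2 - ‖ζ - c‖ ^ 2)) ^ s) =
      ∫⁻ ζ : ℂ, F ‖ζ‖ := by
    rw [← lintegral_sub_right_eq_self (fun ζ : ℂ => F ‖ζ‖) c,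
      ← lintegral_indicator Metric.isOpen_ball.measurableSet]
    congr 1
    ext ζ
    simp [hF, Set.indicator, dist_eq_norm]
  rw [h1, ← Complex.lintegral_comp_polarCoord_symm]
  -- The substitution `r ↦ R - r` turns the radial bound into `∫ r ^ s` over `(0, 1)` whatever `R ≤
  -- 1` is, hence the uniformity.
  set G : ℝ → ℝ≥0∞ := (Set.Ioo (0 : ℝ) 1).indicator fun r => ENNReal.ofReal (r ^ s) with hG
  have hGm : Measurable G := by
    apply Measurable.indicator _ measurableSet_Ioo
    fun_prop
  have h2 : ∀ q ∈ Complex.polarCoord.target,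
      ENNReal.ofReal q.1 • F ‖Complex.polarCoord.symm q‖ ≤
        ENNReal.ofReal (2 ^ (1 + s) * p ^ s) * G (R - q.1) := by
    intro q hq
    rw [Complex.polarCoord_target] at hq
    have hq0 : 0 < q.1 := hq.1
    rw [Complex.norm_polarCoord_symm, abs_of_pos hq0]
    by_cases hqR : q.1 < R
    · have hm : R - q.1 ∈ Set.Ioo (0 : ℝ) 1 := ⟨by linarith, by linarith⟩
      rw [hF, hG, Set.indicator_of_mem (Set.mem_Iio.2 hqR), Set.indicator_of_mem hm, smul_eq_mul,
        ← ENNReal.ofReal_mul hq0.le, ← ENNReal.ofReal_mul (by positivity)]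
      exact ENNReal.ofReal_le_ofReal (mul_rpow_paraboloid_le hs hp hR hq0 hqR)
    · rw [hF, Set.indicator_of_notMem (by simpa using hqR)]
      simp
  calc ∫⁻ q in Complex.polarCoord.target, ENNReal.ofReal q.1 • F ‖Complex.polarCoord.symm q‖
      ≤ ∫⁻ q in Complex.polarCoord.target, ENNReal.ofReal (2 ^ (1 + s) * p ^ s) * G (R - q.1) :=
        setLIntegral_mono' Complex.polarCoord.open_target.measurableSet h2
    _ ≤ ∫⁻ q in (Set.univ : Set ℝ) ×ˢ Set.Ioo (-Real.pi) Real.pi,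
          ENNReal.ofReal (2 ^ (1 + s) * p ^ s) * G (R - q.1) := by
        apply lintegral_mono_set
        rw [Complex.polarCoord_target]
        exact Set.prod_mono (Set.subset_univ _) le_rfl
    _ = ∫⁻ r : ℝ, ∫⁻ _ in Set.Ioo (-Real.pi) Real.pi,
          ENNReal.ofReal (2 ^ (1 + s) * p ^ s) * G (R - r) := by
        rw [Measure.volume_eq_prod, ← Measure.prod_restrict, Measure.restrict_univ,
          lintegral_prod _ (by fun_prop)]
    _ = ENNReal.ofReal (2 * Real.pi) * (ENNReal.ofReal (2 ^ (1 + s) * p ^ s) *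
          ∫⁻ r : ℝ, G (R - r)) := by
        simp only [setLIntegral_const, Real.volume_Ioo]
        rw [lintegral_mul_const _ (by fun_prop), lintegral_const_mul _ (by fun_prop), mul_comm]
        congr 2
        ring
    _ = ENNReal.ofReal (2 * Real.pi) * ENNReal.ofReal (2 ^ (1 + s)) * I *
          ENNReal.ofReal (p ^ s) := by
        rw [lintegral_sub_left_eq_self G R, hG, lintegral_indicator measurableSet_Ioo, ← hI,
          ENNReal.ofReal_mul (p := 2 ^ (1 + s)) (by positivity)]
        ring

/-! ### Isotropic coordinates and integrability of the weight -/

/-- In `domain (m + 2)`, written in the coordinates `ζ = z₀ + i z₁`, `ω = z₀ - i z₁` and `w`, the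
vector `(ω, w)` lies in the unit ball. -/
theorem norm_sq_add_lt_one_of_isotropic {t u b q : ℝ} (hb : 0 ≤ b) (hq : 0 ≤ q)
    (hqb : q ≤ t * u + b) (h1 : (t ^ 2 + u ^ 2) / 2 + b < 1)
    (h2 : 2 * ((t ^ 2 + u ^ 2) / 2 + b) < 1 + q ^ 2) : u ^ 2 + b < 1 := by
  by_contra! h
  -- With `N = (t² + u²) / 2 + b`, the negated claim gives `0 < 1 - N ≤ (u² - t²) / 2`. Since `N² -
  -- (t u + b)² = ((u² - t²) / 2)² + b (t - u)²`, it follows that `1 - 2 N + q² ≤ -b (t - u)² ≤ 0`,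
  -- a contradiction.
  have h3 : (1 - ((t ^ 2 + u ^ 2) / 2 + b)) ^ 2 ≤ ((u ^ 2 - t ^ 2) / 2) ^ 2 :=
    pow_le_pow_left₀ (by linarith) (by linarith) 2
  have h4 : q ^ 2 ≤ (t * u + b) ^ 2 := pow_le_pow_left₀ hq hqb 2
  nlinarith [mul_nonneg hb (sq_nonneg (t - u))]

/-- The coordinates `ζ = z₀ + i z₁`, `ω = z₀ - i z₁`, in which `z₀² + z₁² = ζ ω`. -/
def isotropicCoord (m : ℕ) : (ℂ × ℂ × (Fin m → ℂ)) ≃L[ℂ] (Fin (m + 2) → ℂ) :=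
  LinearEquiv.toContinuousLinearEquiv <|
    show (ℂ × ℂ × (Fin m → ℂ)) ≃ₗ[ℂ] (Fin (m + 2) → ℂ) from
    { toFun := fun x => vecCons ((x.1 + x.2.1) / 2)
        (vecCons (-Complex.I * (x.1 - x.2.1) / 2) x.2.2)
      map_add' := by
        intro x y
        refine funext (Fin.cases ?_ (Fin.cases ?_ ?_)) <;> intros <;> simp <;> ring
      map_smul' := by
        intro c x
        refine funext (Fin.cases ?_ (Fin.cases ?_ ?_)) <;> intros <;> simp <;> ring
      invFun := fun z => (z 0 + Complex.I * z 1, z 0 - Complex.I * z 1, fun i => z i.succ.succ)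
      left_inv := by
        rintro ⟨ζ, ω, w⟩
        have h : Complex.I * (Complex.I * (ζ - ω)) = ω - ζ := by
          rw [← mul_assoc, Complex.I_mul_I]; ring
        refine Prod.ext ?_ (Prod.ext ?_ ?_)
        · simp only [cons_val_zero, cons_val_one, neg_mul, mul_neg, neg_div, mul_div_assoc', h]
          ring
        · simp only [cons_val_zero, cons_val_one, neg_mul, mul_neg, neg_div, mul_div_assoc', h]
          ring
        · ext i
          simp
      right_inv := by
        intro z
        have h : ∀ x, Complex.I * (Complex.I * x) = -x := by
          intro x
          rw [← mul_assoc, Complex.I_mul_I]; ring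
        refine funext (Fin.cases ?_ (Fin.cases ?_ ?_))
        · simp
        · simp only [Fin.succ_zero_eq_one]
          ring_nf
          simp
        · intro i
          simp }

theorem isotropicCoord_apply (m : ℕ) (ζ ω : ℂ) (w : Fin m → ℂ) :
    isotropicCoord m (ζ, ω, w) =
      vecCons ((ζ + ω) / 2) (vecCons (-Complex.I * (ζ - ω) / 2) w) := rfl

theorem sum_norm_sq_isotropicCoord (m : ℕ) (ζ ω : ℂ) (w : Fin m → ℂ) :
    ∑ i, ‖isotropicCoord m (ζ, ω, w) i‖ ^ 2 = (‖ζ‖ ^ 2 + ‖ω‖ ^ 2) / 2 + ∑ i, ‖w i‖ ^ 2 := by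
  simp only [isotropicCoord_apply, Fin.sum_univ_succ, cons_val_zero, cons_val_succ, norm_div,
    norm_mul, norm_neg, Complex.norm_I, ← add_assoc]
  congr 1
  simp only [div_pow, mul_pow, Complex.sq_norm, Complex.normSq_apply, Complex.norm_ofNat]
  simp
  ring

theorem dotProduct_isotropicCoord (m : ℕ) (ζ ω : ℂ) (w : Fin m → ℂ) :
    isotropicCoord m (ζ, ω, w) ⬝ᵥ isotropicCoord m (ζ, ω, w) = ζ * ω + w ⬝ᵥ w := by
  simp only [isotropicCoord_apply, dotProduct, Fin.sum_univ_succ, cons_val_zero, cons_val_succ,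
    ← add_assoc]
  congr 1
  ring_nf
  simp
  ring

theorem norm_dotProduct_self_le {ι : Type*} [Fintype ι] (w : ι → ℂ) :
    ‖w ⬝ᵥ w‖ ≤ ∑ i, ‖w i‖ ^ 2 := by
  refine (norm_sum_le _ _).trans (le_of_eq ?_)
  simp [sq]

/-- Completing the square: for fixed `ω` and `w`, the terms of `Δ` involving `ζ` are `-(1 - |ω|²)
|ζ|²` and `2 Re (ζ ω conj q)` with `q = wᵀw`. Each slice of the weight is thus a power of a concave
paraboloid. -/
theorem Delta_isotropicCoord (m : ℕ) (ζ ω : ℂ) (w : Fin m → ℂ) (hω : 1 - ‖ω‖ ^ 2 ≠ 0) :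
    Delta (isotropicCoord m (ζ, ω, w)) = (1 - ‖ω‖ ^ 2) *
      ((1 - 2 * (∑ i, ‖w i‖ ^ 2) / (1 - ‖ω‖ ^ 2) + (‖w ⬝ᵥ w‖ / (1 - ‖ω‖ ^ 2)) ^ 2) -
        ‖ζ - (starRingEnd ℂ) ω * (w ⬝ᵥ w) / ((1 - ‖ω‖ ^ 2 : ℝ) : ℂ)‖ ^ 2) := by
  rw [Delta, sum_norm_sq_isotropicCoord, dotProduct_isotropicCoord]
  generalize w ⬝ᵥ w = q
  have h : ‖ζ - (starRingEnd ℂ) ω * q / ((1 - ‖ω‖ ^ 2 : ℝ) : ℂ)‖ ^ 2 =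
      ‖((1 - ‖ω‖ ^ 2 : ℝ) : ℂ) * ζ - (starRingEnd ℂ) ω * q‖ ^ 2 / (1 - ‖ω‖ ^ 2) ^ 2 := by
    have h0 : ((1 - ‖ω‖ ^ 2 : ℝ) : ℂ) ≠ 0 := Complex.ofReal_ne_zero.2 hω
    rw [eq_div_iff (pow_ne_zero 2 hω), ← sq_abs (1 - ‖ω‖ ^ 2), ← Real.norm_eq_abs,
      ← Complex.norm_real, ← mul_pow, ← norm_mul]
    congr 2
    field_simp
  rw [h]
  have h2 : ‖((1 - ‖ω‖ ^ 2 : ℝ) : ℂ) * ζ - (starRingEnd ℂ) ω * q‖ ^ 2 =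
      (1 - ‖ω‖ ^ 2) ^ 2 * ‖ζ‖ ^ 2 - 2 * (1 - ‖ω‖ ^ 2) * (ζ * ω * (starRingEnd ℂ) q).re +
        ‖ω‖ ^ 2 * ‖q‖ ^ 2 := by
    generalize 1 - ‖ω‖ ^ 2 = p
    simp only [Complex.sq_norm, Complex.normSq_apply]
    simp
    ring
  have h3 : ‖ζ * ω + q‖ ^ 2 = ‖ζ‖ ^ 2 * ‖ω‖ ^ 2 + 2 * (ζ * ω * (starRingEnd ℂ) q).re +
      ‖q‖ ^ 2 := by
    simp only [Complex.sq_norm, Complex.normSq_apply]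
    simp
    ring
  rw [h2, h3]
  field_simp
  ring

theorem isotropicCoord_mem_domain {m : ℕ} {ζ ω : ℂ} {w : Fin m → ℂ}
    (h : isotropicCoord m (ζ, ω, w) ∈ domain (m + 2)) : ‖ω‖ ^ 2 + ∑ i, ‖w i‖ ^ 2 < 1 := by
  obtain ⟨h1, h2⟩ := h
  rw [sum_norm_sq_isotropicCoord, dotProduct_isotropicCoord] at *
  refine norm_sq_add_lt_one_of_isotropic (t := ‖ζ‖) (by positivity)
    (norm_nonneg (ζ * ω + w ⬝ᵥ w)) ?_ h1 h2
  rw [← norm_mul]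
  refine (norm_add_le _ _).trans ?_
  have := norm_dotProduct_self_le w
  linarith

/-- On a slice, `Δ = p (A - |ζ - c|²)` with `p = 1 - |ω|²`, so the slice of the domain lies in the
disc of radius `√A` about `c`, and the uniform paraboloid bound applies. -/
theorem exists_lintegral_isotropicCoord_le {s : ℝ} (hs : -1 < s) (m : ℕ) :
    ∃ C : ℝ≥0∞, C ≠ ∞ ∧ ∀ (ω : ℂ) (w : Fin m → ℂ),
      ∫⁻ ζ, (domain (m + 2)).indicator (fun z => ENNReal.ofReal (Delta z ^ s))
        (isotropicCoord m (ζ, ω, w)) ≤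
      (Metric.ball 0 1).indicator (fun ω => C * ENNReal.ofReal ((1 - ‖ω‖ ^ 2) ^ s)) ω *
        (Metric.ball 0 1).indicator 1 w := by
  obtain ⟨C, hC, hle⟩ := exists_lintegral_paraboloid_le hs
  refine ⟨C, hC, fun ω w => ?_⟩
  by_cases hb : ‖ω‖ ^ 2 + ∑ i, ‖w i‖ ^ 2 < 1
  swap
  · have h0 : ∀ ζ, (domain (m + 2)).indicator (fun z => ENNReal.ofReal (Delta z ^ s))
        (isotropicCoord m (ζ, ω, w)) = 0 := fun ζ =>
      Set.indicator_of_notMem (fun h => hb (isotropicCoord_mem_domain h)) _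
    simp [h0]
  have hb0 : 0 ≤ ∑ i, ‖w i‖ ^ 2 := by positivity
  have hp : 0 < 1 - ‖ω‖ ^ 2 := by linarith
  have hω : ω ∈ Metric.ball (0 : ℂ) 1 := by
    rw [mem_ball_zero_iff]
    nlinarith [norm_nonneg ω]
  have hw : w ∈ Metric.ball (0 : Fin m → ℂ) 1 := by
    rw [mem_ball_zero_iff, pi_norm_lt_iff one_pos]
    intro i
    have h1 : ‖w i‖ ^ 2 ≤ ∑ i, ‖w i‖ ^ 2 :=
      Finset.single_le_sum (f := fun i => ‖w i‖ ^ 2) (fun _ _ => by positivity) (Finset.mem_univ i)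
    nlinarith [norm_nonneg (w i), sq_nonneg ‖ω‖]
  rw [Set.indicator_of_mem hω, Set.indicator_of_mem hw, Pi.one_apply, mul_one]
  set p := 1 - ‖ω‖ ^ 2 with hpdef
  set b := ∑ i, ‖w i‖ ^ 2
  set A : ℝ := 1 - 2 * b / p + (‖w ⬝ᵥ w‖ / p) ^ 2 with hA
  set c : ℂ := (starRingEnd ℂ) ω * (w ⬝ᵥ w) / ((1 - ‖ω‖ ^ 2 : ℝ) : ℂ) with hc
  -- With `x = b / p ∈ [0, 1]`, `A ≤ 1 - 2 x + x² ≤ 1`.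
  have hA1 : A ≤ 1 := by
    have h1 : (‖w ⬝ᵥ w‖ / p) ^ 2 ≤ (b / p) ^ 2 := by
      gcongr
      exact norm_dotProduct_self_le w
    have h2 : b / p ≤ 1 := (div_le_one hp).2 (by linarith)
    have h3 : 0 ≤ b / p := by positivity
    rw [hA, mul_div_assoc]
    nlinarith
  refine le_trans ?_ (hle c p (Real.sqrt A) hp (Real.sqrt_le_one.2 hA1))
  rw [← lintegral_indicator Metric.isOpen_ball.measurableSet]
  apply lintegral_mono
  intro ζ
  by_cases hz : isotropicCoord m (ζ, ω, w) ∈ domain (m + 2)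
  swap
  · simp only [Set.indicator_of_notMem hz]
    exact zero_le
  have hΔ : Delta (isotropicCoord m (ζ, ω, w)) = p * (A - ‖ζ - c‖ ^ 2) :=
    Delta_isotropicCoord m ζ ω w hp.ne'
  have hpos : 0 < A - ‖ζ - c‖ ^ 2 := by
    have := Delta_pos hz
    rw [hΔ] at this
    exact pos_of_mul_pos_right this hp.le
  have hζ : ζ ∈ Metric.ball c (Real.sqrt A) := by
    rw [Metric.mem_ball, dist_eq_norm]
    exact Real.lt_sqrt_of_sq_lt (by linarith)
  have hA0 : 0 ≤ A := by nlinarith [sq_nonneg ‖ζ - c‖]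
  simp only [Set.indicator_of_mem hz, Set.indicator_of_mem hζ, hΔ, Real.sq_sqrt hA0]
  exact le_rfl

/-- Integrating over `ζ` first leaves `(1 - |ω|²) ^ s` on the unit disc and a bounded range for `w`;
the disc integral is again a paraboloid integral, with `c = 0` and `p = R = 1`. Uniqueness of Haar
measure accounts for the linear change of variables up to a finite constant. -/
theorem weighted_univ_lt_top {n : ℕ} (hn : 2 ≤ n) {lam : ℝ} (hlam : (n : ℝ) - 1 < lam) :
    weighted n lam Set.univ < ∞ := by
  obtain ⟨m, rfl⟩ := Nat.exists_eq_add_of_le' hn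
  have hs : -1 < lam - ((m + 2 : ℕ) : ℝ) := by linarith
  set s := lam - ((m + 2 : ℕ) : ℝ)
  obtain ⟨C, hC, hle⟩ := exists_lintegral_isotropicCoord_le hs m
  obtain ⟨C', hC', hle'⟩ := exists_lintegral_paraboloid_le hs
  set F : (Fin (m + 2) → ℂ) → ℝ≥0∞ :=
    (domain (m + 2)).indicator (fun z => ENNReal.ofReal (Delta z ^ s)) with hF
  have hFm : Measurable F :=
    (((continuous_Delta _).measurable.pow_const s).ennreal_ofReal).indicator
      (isOpen_domain _).measurableSet
  have hLm : Measurable (isotropicCoord m) := (isotropicCoord m).continuous.measurable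
  have : (volume : Measure (ℂ × (Fin m → ℂ))).IsAddHaarMeasure :=
    Measure.prod.instIsAddHaarMeasure volume volume
  have : (volume : Measure (ℂ × ℂ × (Fin m → ℂ))).IsAddHaarMeasure :=
    Measure.prod.instIsAddHaarMeasure volume volume
  have hvol : (volume : Measure (Fin (m + 2) → ℂ)) =
      Measure.addHaarScalarFactor volume (Measure.map (isotropicCoord m) volume) •
        Measure.map (isotropicCoord m) volume :=
    Measure.isAddLeftInvariant_eq_smul _ _
  have hfin : ∫⁻ x, F (isotropicCoord m x) < ∞ := by
    calc ∫⁻ x, F (isotropicCoord m x)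
        = ∫⁻ y : ℂ × (Fin m → ℂ), ∫⁻ ζ, F (isotropicCoord m (ζ, y)) :=
          lintegral_prod_symm' _ (hFm.comp hLm)
      _ ≤ ∫⁻ y : ℂ × (Fin m → ℂ),
            (Metric.ball 0 1).indicator (fun ω => C * ENNReal.ofReal ((1 - ‖ω‖ ^ 2) ^ s)) y.1 *
              (Metric.ball 0 1).indicator 1 y.2 := lintegral_mono fun y => hle y.1 y.2
      _ = (∫⁻ ω in Metric.ball (0 : ℂ) 1, C * ENNReal.ofReal ((1 - ‖ω‖ ^ 2) ^ s)) *
            volume (Metric.ball (0 : Fin m → ℂ) 1) := by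
          rw [Measure.volume_eq_prod, lintegral_prod_mul, lintegral_indicator,
            lintegral_indicator_one]
          · exact Metric.isOpen_ball.measurableSet
          · exact Metric.isOpen_ball.measurableSet
          · exact ((by fun_prop : Measurable fun ω : ℂ =>
              C * ENNReal.ofReal ((1 - ‖ω‖ ^ 2) ^ s)).indicator
                Metric.isOpen_ball.measurableSet).aemeasurable
          · exact (measurable_one.indicator Metric.isOpen_ball.measurableSet).aemeasurable
      _ < ∞ := by
          refine ENNReal.mul_lt_top ?_ measure_ball_lt_top
          rw [lintegral_const_mul _ (by fun_prop)]
          refine ENNReal.mul_lt_top hC.lt_top ?_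
          have := hle' 0 1 1 one_pos le_rfl
          simp only [one_mul, one_pow, sub_zero, Real.one_rpow, ENNReal.ofReal_one, mul_one] at this
          exact this.trans_lt hC'.lt_top
  have h1 : weighted (m + 2) lam Set.univ = ∫⁻ z, F z := by
    rw [weighted, withDensity_apply _ MeasurableSet.univ, Measure.restrict_univ, hF,
      lintegral_indicator (isOpen_domain _).measurableSet]
  rw [h1, hvol, lintegral_smul_measure, lintegral_map hFm hLm]
  exact ENNReal.mul_lt_top ENNReal.coe_lt_top hfin

/-! ### The domain and its symmetries -/

theorem zero_mem_domain (n : ℕ) : (0 : Fin n → ℂ) ∈ domain n := by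
  simp [domain]

/-- The domain is balanced: with `t = |c|²`, `N = |z|²` and `Q = |zᵀz|² ≤ N < 1`, one has `1 + t² Q
- 2 t N = t (1 + Q - 2 N) + (1 - t)(1 - t Q) > 0`. This permits restriction to complex lines through
the origin. -/
theorem smul_mem_domain {n : ℕ} {z : Fin n → ℂ} (hz : z ∈ domain n) {c : ℂ} (hc : ‖c‖ ≤ 1) :
    c • z ∈ domain n := by
  obtain ⟨h1, h2⟩ := hz
  have hq := norm_dotProduct_self_le z
  have hN : 0 ≤ ∑ i, ‖z i‖ ^ 2 := by positivity
  have e1 : ∑ i, ‖(c • z) i‖ ^ 2 = ‖c‖ ^ 2 * ∑ i, ‖z i‖ ^ 2 := by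
    simp [mul_pow, Finset.mul_sum]
  have e2 : ‖(c • z) ⬝ᵥ (c • z)‖ ^ 2 = (‖c‖ ^ 2) ^ 2 * ‖z ⬝ᵥ z‖ ^ 2 := by
    rw [smul_dotProduct, dotProduct_smul]
    simp only [smul_eq_mul, norm_mul]
    ring
  simp only [domain, Set.mem_ofPred_eq]
  rw [e1, e2]
  have ht : ‖c‖ ^ 2 ≤ 1 := pow_le_one₀ (norm_nonneg c) hc
  have ht0 : 0 ≤ ‖c‖ ^ 2 := by positivity
  have hq0 := norm_nonneg (z ⬝ᵥ z)
  generalize ‖c‖ ^ 2 = t at *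
  generalize ∑ i, ‖z i‖ ^ 2 = N at *
  generalize ‖z ⬝ᵥ z‖ = q at *
  have hQ : q ^ 2 ≤ N := by nlinarith
  refine ⟨by nlinarith, ?_⟩
  nlinarith [mul_nonneg (sub_nonneg.2 ht) (sub_nonneg.2 hQ),
    mul_nonneg (mul_nonneg (sub_nonneg.2 ht) (sub_nonneg.2 ht)) (sq_nonneg q)]

theorem weighted_univ_ne_zero (n : ℕ) (lam : ℝ) : weighted n lam Set.univ ≠ 0 := by
  rw [weighted, withDensity_apply _ MeasurableSet.univ, Measure.restrict_univ]
  have hm : Measurable fun z : Fin n → ℂ => ENNReal.ofReal (Delta z ^ (lam - n)) :=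
    ((continuous_Delta _).measurable.pow_const _).ennreal_ofReal
  refine ((setLIntegral_pos_iff hm).2 ?_).ne'
  refine ((isOpen_domain n).measure_pos _ ⟨0, zero_mem_domain n⟩).trans_le (measure_mono ?_)
  intro z hz
  exact ⟨by simpa using Real.rpow_pos_of_pos (Delta_pos hz) _, hz⟩

/-- If the total mass were infinite, its inverse would be `0`, `vMeasure` would vanish, and
noncommutativity would fail. -/
theorem isProbabilityMeasure_vMeasure {n : ℕ} (hn : 2 ≤ n) {lam : ℝ} (hlam : (n : ℝ) - 1 < lam) :
    IsProbabilityMeasure (vMeasure n lam) := by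
  refine ⟨?_⟩
  rw [vMeasure, Measure.smul_apply, smul_eq_mul]
  exact ENNReal.inv_mul_cancel (weighted_univ_ne_zero n lam) (weighted_univ_lt_top hn hlam).ne

theorem ae_mem_domain (n : ℕ) (lam : ℝ) : ∀ᵐ z ∂vMeasure n lam, z ∈ domain n :=
  vMeasure_compl n lam

/-- On small balls the measure `vMeasure` dominates a multiple of Lebesgue measure. -/
theorem exists_smul_restrict_le_vMeasure {n : ℕ} (hn : 2 ≤ n) {lam : ℝ}
    (hlam : (n : ℝ) - 1 < lam) {z₀ : Fin n → ℂ} {R : ℝ} (hR : 0 ≤ R)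
    (hsub : Metric.closedBall z₀ R ⊆ domain n) :
    ∃ ε : ℝ≥0∞, ε ≠ 0 ∧ ε ≠ ∞ ∧
      ε • volume.restrict (Metric.closedBall z₀ R) ≤ vMeasure n lam := by
  have hz₀ : z₀ ∈ domain n := hsub (Metric.mem_closedBall_self hR)
  have hcont : ContinuousOn (fun z : Fin n → ℂ => Delta z ^ (lam - n)) (Metric.closedBall z₀ R) :=
    fun z hz => ((continuous_Delta n).continuousAt.rpow_const
      (Or.inl (Delta_pos (hsub hz)).ne')).continuousWithinAt
  obtain ⟨z₁, hz₁, hmin⟩ := (isCompact_closedBall z₀ R).exists_isMinOn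
    ⟨z₀, Metric.mem_closedBall_self hR⟩ hcont
  set m : ℝ := Delta z₁ ^ (lam - n)
  have hm : 0 < m := Real.rpow_pos_of_pos (Delta_pos (hsub hz₁)) _
  have hc0 : (weighted n lam Set.univ)⁻¹ ≠ 0 :=
    ENNReal.inv_ne_zero.2 (weighted_univ_lt_top hn hlam).ne
  have hct : (weighted n lam Set.univ)⁻¹ ≠ ∞ :=
    ENNReal.inv_ne_top.2 (weighted_univ_ne_zero n lam)
  refine ⟨(weighted n lam Set.univ)⁻¹ * ENNReal.ofReal m, mul_ne_zero hc0 (by simpa using hm),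
    ENNReal.mul_ne_top hct ENNReal.ofReal_ne_top, ?_⟩
  rw [mul_smul, vMeasure, Measure.le_iff]
  intro s hs
  rw [Measure.smul_apply, Measure.smul_apply]
  refine mul_le_mul' le_rfl ?_
  change _ ≤ weighted n lam s
  rw [weighted, withDensity_apply _ hs, Measure.restrict_restrict hs,
    Measure.restrict_apply hs, smul_eq_mul]
  calc ENNReal.ofReal m * volume (s ∩ Metric.closedBall z₀ R)
      = ∫⁻ z in s ∩ Metric.closedBall z₀ R, ENNReal.ofReal m := by rw [setLIntegral_const]
    _ ≤ ∫⁻ z in s ∩ Metric.closedBall z₀ R, ENNReal.ofReal (Delta z ^ (lam - n)) :=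
        setLIntegral_mono' (hs.inter Metric.isClosed_closedBall.measurableSet)
          fun z hz => ENNReal.ofReal_le_ofReal (hmin hz.2)
    _ ≤ _ := lintegral_mono_set (Set.inter_subset_inter_right s hsub)

/-- Two continuous functions that differ at a point of the domain differ on a small closed ball,
which has positive measure. -/
theorem eqOn_domain_of_ae_eq {n : ℕ} (hn : 2 ≤ n) {lam : ℝ} (hlam : (n : ℝ) - 1 < lam)
    {f g : (Fin n → ℂ) → ℂ} (hf : ContinuousOn f (domain n)) (hg : ContinuousOn g (domain n))
    (h : f =ᵐ[vMeasure n lam] g) : Set.EqOn f g (domain n) := by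
  by_contra hne
  simp only [Set.EqOn, not_forall] at hne
  obtain ⟨z₀, hz₀, hne⟩ := hne
  have hev : ∀ᶠ z in nhds z₀, z ∈ domain n ∧ f z ≠ g z := by
    have hD := (isOpen_domain n).mem_nhds hz₀
    exact Filter.Eventually.and hD
      ((((hf.continuousAt hD).sub (hg.continuousAt hD)).eventually_ne (sub_ne_zero.2 hne)).mono
        fun z hz => sub_ne_zero.1 hz)
  obtain ⟨R, hR, hsub⟩ := Metric.nhds_basis_closedBall.mem_iff.1 hev
  obtain ⟨ε, hε, -, hle⟩ := exists_smul_restrict_le_vMeasure hn hlam hR.le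
    (fun z hz => (hsub hz).1)
  have h0 : vMeasure n lam (Metric.closedBall z₀ R) = 0 :=
    measure_mono_null (fun z hz => (hsub hz).2) (ae_iff.1 h)
  have h1 := hle (Metric.closedBall z₀ R)
  rw [h0, Measure.smul_apply, Measure.restrict_apply_self, smul_eq_mul, nonpos_iff_eq_zero,
    mul_eq_zero] at h1
  exact h1.elim hε (Metric.measure_closedBall_pos _ _ hR).ne'

theorem norm_le_one_of_mem_domain {n : ℕ} {z : Fin n → ℂ} (hz : z ∈ domain n) : ‖z‖ ≤ 1 := by
  rw [pi_norm_le_iff_of_nonneg zero_le_one]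
  intro i
  have h1 : ‖z i‖ ^ 2 ≤ ∑ i, ‖z i‖ ^ 2 :=
    Finset.single_le_sum (f := fun i => ‖z i‖ ^ 2) (fun _ _ => by positivity) (Finset.mem_univ i)
  nlinarith [hz.1, norm_nonneg (z i)]

theorem volume_domain_ne_top (n : ℕ) : volume (domain n) ≠ ∞ :=
  ne_top_of_le_ne_top (measure_closedBall_lt_top (x := 0) (r := 1)).ne
    (measure_mono fun _ hz => mem_closedBall_zero_iff.2 (norm_le_one_of_mem_domain hz))

/-- A real-linear automorphism that preserves `|z|²` and `|zᵀz|` preserves `vMeasure`. -/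
theorem measurePreserving_vMeasure {n : ℕ} (lam : ℝ) (L : (Fin n → ℂ) ≃L[ℝ] (Fin n → ℂ))
    (h1 : ∀ z, ∑ i, ‖L z i‖ ^ 2 = ∑ i, ‖z i‖ ^ 2) (h2 : ∀ z, ‖L z ⬝ᵥ L z‖ = ‖z ⬝ᵥ z‖) :
    MeasurePreserving L (vMeasure n lam) (vMeasure n lam) := by
  have hD : L ⁻¹' domain n = domain n := by
    ext z
    simp [domain, h1, h2]
  have hΔ : ∀ z, Delta (L z) = Delta z := fun z => by simp [Delta, h1, h2]
  have hm : Measurable L := L.continuous.measurable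
  have hv : MeasurePreserving L volume volume := by
    refine ⟨hm, ?_⟩
    -- By uniqueness of Haar measure `L` scales volume by a constant. The constant is `1` because
    -- the domain has positive finite volume and equals its own preimage, so no determinant is
    -- needed.
    have hs := Measure.isAddLeftInvariant_eq_smul (Measure.map L volume)
      (volume : Measure (Fin n → ℂ))
    set c := Measure.addHaarScalarFactor (Measure.map L volume) (volume : Measure (Fin n → ℂ))
    have h3 : volume (domain n) = c * volume (domain n) := by
      calc volume (domain n) = Measure.map L volume (domain n) := by
            rw [Measure.map_apply hm (isOpen_domain n).measurableSet, hD]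
        _ = _ := by rw [hs]; rfl
    have h4 : (c : ℝ≥0∞) = 1 := by
      have hpos : volume (domain n) ≠ 0 :=
        ((isOpen_domain n).measure_pos _ ⟨0, zero_mem_domain n⟩).ne'
      have := (ENNReal.mul_left_inj hpos (volume_domain_ne_top n)).1 ((one_mul _).trans h3)
      exact this.symm
    have h5 : c = 1 := by exact_mod_cast h4
    rw [hs, h5, one_smul]
  have hw : Measure.map L (weighted n lam) = weighted n lam := by
    ext s hs
    rw [Measure.map_apply hm hs, weighted, withDensity_apply _ hs, withDensity_apply _ (hm hs),
      Measure.restrict_restrict hs, Measure.restrict_restrict (hm hs)]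
    have := hv.setLIntegral_comp_preimage_emb L.toHomeomorph.measurableEmbedding
      (fun z => ENNReal.ofReal (Delta z ^ (lam - n))) (s ∩ domain n)
    rw [← this, Set.preimage_inter, hD]
    simp only [hΔ]
  refine ⟨hm, ?_⟩
  rw [vMeasure, Measure.map_smul, hw]

/-! ### The action of `SO(n) × SO(2)` and complex conjugation on the domain -/

theorem act_one {n : ℕ} (z : Fin n → ℂ) : act 1 z = z := by
  simp [act]

theorem act_mul {n : ℕ} (g h : K n) (z : Fin n → ℂ) : act (g * h) z = act g (act h z) := by
  simp only [act, Prod.fst_mul, Prod.snd_mul, Circle.coe_mul, mulVec_smul, mulVec_mulVec,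
    smul_smul]
  congr 2
  exact Matrix.map_mul (f := Complex.ofRealHom)

/-- The action of an element of `SO(n) × SO(2)` as a linear automorphism. -/
def actEquiv {n : ℕ} (g : K n) : (Fin n → ℂ) ≃L[ℂ] (Fin n → ℂ) :=
  LinearEquiv.toContinuousLinearEquiv
    { toFun := act g
      map_add' := fun x y => by simp [act, mulVec_add]
      map_smul' := fun c x => by simp [act, mulVec_smul, smul_comm c]
      invFun := act g⁻¹
      left_inv := fun z => by rw [← act_mul, inv_mul_cancel, act_one]
      right_inv := fun z => by rw [← act_mul, mul_inv_cancel, act_one] }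

theorem map_transpose_mul_self {n : ℕ} (A : SO n) :
    (A.1.map ((↑) : ℝ → ℂ))ᵀ * A.1.map ((↑) : ℝ → ℂ) = 1 := by
  have h : A.1ᵀ * A.1 = 1 := by
    have := (mem_SO_iff.1 A.2).1
    exact mul_eq_one_comm.1 this
  have h2 : (A.1ᵀ * A.1).map Complex.ofRealHom = 1 := by
    rw [h]
    exact Matrix.map_one _ (map_zero _) (map_one _)
  rw [Matrix.map_mul] at h2
  exact h2

theorem dotProduct_act {n : ℕ} (g : K n) (z : Fin n → ℂ) :
    act g z ⬝ᵥ act g z = (g.2 : ℂ) ^ 2 * (z ⬝ᵥ z) := by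
  rw [act, smul_dotProduct, dotProduct_smul, dotProduct_mulVec, vecMul_mulVec,
    map_transpose_mul_self]
  simp
  ring

theorem norm_dotProduct_act {n : ℕ} (g : K n) (z : Fin n → ℂ) :
    ‖act g z ⬝ᵥ act g z‖ = ‖z ⬝ᵥ z‖ := by
  have hg : ‖(g.2 : ℂ)‖ = 1 := Circle.norm_coe g.2
  rw [dotProduct_act, norm_mul, norm_pow, hg, one_pow, one_mul]

theorem sum_norm_sq_eq {n : ℕ} (z : Fin n → ℂ) :
    ((∑ i, ‖z i‖ ^ 2 : ℝ) : ℂ) = star z ⬝ᵥ z := by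
  simp [dotProduct, Complex.conj_mul']

theorem sum_norm_sq_act {n : ℕ} (g : K n) (z : Fin n → ℂ) :
    ∑ i, ‖act g z i‖ ^ 2 = ∑ i, ‖z i‖ ^ 2 := by
  have hs : star (act g z) = (starRingEnd ℂ) (g.2 : ℂ) •
      (g.1.1.map ((↑) : ℝ → ℂ) *ᵥ star z) := by
    ext i
    simp [act, mulVec, dotProduct]
  have h : ((∑ i, ‖act g z i‖ ^ 2 : ℝ) : ℂ) = ((∑ i, ‖z i‖ ^ 2 : ℝ) : ℂ) := by
    rw [sum_norm_sq_eq, sum_norm_sq_eq, hs, act, smul_dotProduct, dotProduct_smul,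
      dotProduct_mulVec, vecMul_mulVec, map_transpose_mul_self]
    have hg : ‖(g.2 : ℂ)‖ = 1 := Circle.norm_coe g.2
    rw [smul_smul, Complex.conj_mul', hg]
    simp
  exact_mod_cast h

theorem measurePreserving_act {n : ℕ} (lam : ℝ) (g : K n) :
    MeasurePreserving (act g) (vMeasure n lam) (vMeasure n lam) :=
  measurePreserving_vMeasure lam ((actEquiv g).restrictScalars ℝ)
    (fun z => sum_norm_sq_act g z) (fun z => norm_dotProduct_act g z)

theorem act_mem_domain {n : ℕ} (g : K n) {z : Fin n → ℂ} (hz : z ∈ domain n) :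
    act g z ∈ domain n := by
  simpa [domain, sum_norm_sq_act, norm_dotProduct_act] using hz

theorem differentiable_act {n : ℕ} (g : K n) : Differentiable ℂ (act (n := n) g) :=
  (actEquiv g).differentiable

theorem measurePreserving_star {n : ℕ} (lam : ℝ) :
    MeasurePreserving (star : (Fin n → ℂ) → Fin n → ℂ) (vMeasure n lam) (vMeasure n lam) := by
  refine measurePreserving_vMeasure lam (starL' ℝ (A := Fin n → ℂ)) (fun z => by simp)
    (fun z => ?_)
  rw [starL'_apply, star_dotProduct_star, norm_star]

theorem star_mem_domain {n : ℕ} {z : Fin n → ℂ} (hz : z ∈ domain n) : star z ∈ domain n := by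
  have h : ‖star z ⬝ᵥ star z‖ = ‖z ⬝ᵥ z‖ := by rw [star_dotProduct_star, norm_star]
  simpa [domain, h] using hz

open scoped InnerProductSpace

/-! ### Holomorphic representatives and integral formulas -/

variable {n : ℕ} {lam : ℝ}

theorem exists_holo (f : BergmanSpace n lam) : ∃ h : (Fin n → ℂ) → ℂ,
    DifferentiableOn ℂ h (domain n) ∧ bergmanIncl n lam f =ᵐ[vMeasure n lam] h :=
  (show bergman n lam from f).2

/-- The holomorphic representative of an element of the Bergman space. -/
def holo (f : BergmanSpace n lam) : (Fin n → ℂ) → ℂ := (exists_holo f).choose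

theorem differentiableOn_holo (f : BergmanSpace n lam) :
    DifferentiableOn ℂ (holo f) (domain n) := (exists_holo f).choose_spec.1

theorem incl_ae_eq_holo (f : BergmanSpace n lam) :
    bergmanIncl n lam f =ᵐ[vMeasure n lam] holo f := (exists_holo f).choose_spec.2

theorem memLp_holo (f : BergmanSpace n lam) : MemLp (holo f) 2 (vMeasure n lam) :=
  (Lp.memLp (bergmanIncl n lam f)).ae_eq (incl_ae_eq_holo f)

/-- The element of the Bergman space represented by a square integrable holomorphic function. -/
def mkBergman (h : (Fin n → ℂ) → ℂ) (hd : DifferentiableOn ℂ h (domain n))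
    (hL : MemLp h 2 (vMeasure n lam)) : BergmanSpace n lam :=
  (⟨hL.toLp h, h, hd, hL.coeFn_toLp⟩ : bergman n lam)

theorem incl_mkBergman (h : (Fin n → ℂ) → ℂ) (hd : DifferentiableOn ℂ h (domain n))
    (hL : MemLp h 2 (vMeasure n lam)) : bergmanIncl n lam (mkBergman h hd hL) = hL.toLp h := rfl

/-- `holo` is obtained by choice; this makes the choice irrelevant on the domain, where a continuous
representative is unique. Pointwise identities for `holo` rest on it. -/
theorem holo_eqOn (hn : 2 ≤ n) (hlam : (n : ℝ) - 1 < lam) {f : BergmanSpace n lam}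
    {h : (Fin n → ℂ) → ℂ} (hh : ContinuousOn h (domain n))
    (hf : bergmanIncl n lam f =ᵐ[vMeasure n lam] h) : Set.EqOn (holo f) h (domain n) :=
  eqOn_domain_of_ae_eq hn hlam (differentiableOn_holo f).continuousOn hh
    ((incl_ae_eq_holo f).symm.trans hf)

theorem holo_mkBergman (hn : 2 ≤ n) (hlam : (n : ℝ) - 1 < lam) (h : (Fin n → ℂ) → ℂ)
    (hd : DifferentiableOn ℂ h (domain n)) (hL : MemLp h 2 (vMeasure n lam)) :
    Set.EqOn (holo (mkBergman h hd hL)) h (domain n) :=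
  holo_eqOn hn hlam hd.continuousOn (by rw [incl_mkBergman]; exact hL.coeFn_toLp)

theorem holo_add (hn : 2 ≤ n) (hlam : (n : ℝ) - 1 < lam) (f g : BergmanSpace n lam) :
    Set.EqOn (holo (f + g)) (holo f + holo g) (domain n) := by
  refine holo_eqOn hn hlam
    ((differentiableOn_holo f).continuousOn.add (differentiableOn_holo g).continuousOn) ?_
  rw [map_add]
  exact (Lp.coeFn_add _ _).trans ((incl_ae_eq_holo f).add (incl_ae_eq_holo g))

theorem holo_smul (hn : 2 ≤ n) (hlam : (n : ℝ) - 1 < lam) (c : ℂ) (f : BergmanSpace n lam) :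
    Set.EqOn (holo (c • f)) (c • holo f) (domain n) := by
  refine holo_eqOn hn hlam ((differentiableOn_holo f).continuousOn.const_smul c) ?_
  rw [map_smul]
  exact (Lp.coeFn_smul _ _).trans ((incl_ae_eq_holo f).const_smul c)

theorem eq_of_holo_eqOn {f g : BergmanSpace n lam} (h : Set.EqOn (holo f) (holo g) (domain n)) :
    f = g := by
  apply (bergmanIncl n lam).injective
  apply Lp.ext
  filter_upwards [incl_ae_eq_holo f, incl_ae_eq_holo g, ae_mem_domain n lam] with z h1 h2 h3
  rw [h1, h2, h h3]

theorem inner_eq_integral (f g : BergmanSpace n lam) :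
    ⟪f, g⟫_ℂ = ∫ z, holo g z * star (holo f z) ∂vMeasure n lam := by
  rw [← (bergmanIncl n lam).inner_map_map, L2.inner_def]
  apply integral_congr_ae
  filter_upwards [incl_ae_eq_holo f, incl_ae_eq_holo g] with z h1 h2
  rw [h1, h2]
  rfl

theorem mulOp_ae_eq (a : Lp ℂ ∞ (vMeasure n lam)) (F : Lp ℂ 2 (vMeasure n lam)) :
    mulOp n lam a F =ᵐ[vMeasure n lam] fun z => a z * F z :=
  (ContinuousLinearMap.mul ℂ ℂ).coeFn_holder (r := 2) a F

/-- The Bergman projection disappears because it is paired with a vector of the Bergman space. The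
integral properties of Toeplitz operators are read off from this formula. -/
theorem inner_toeplitz (a : Lp ℂ ∞ (vMeasure n lam)) (f g : BergmanSpace n lam) :
    ⟪g, toeplitz n lam a f⟫_ℂ =
      ∫ z, a z * holo f z * star (holo g z) ∂vMeasure n lam := by
  have h1 : ⟪g, toeplitz n lam a f⟫_ℂ =
      ⟪bergmanIncl n lam g, mulOp n lam a (bergmanIncl n lam f)⟫_ℂ := by
    have : CompleteSpace (bergman n lam) := (isClosed_bergman n lam).completeSpace_coe
    exact Submodule.inner_orthogonalProjectionOnto_eq_of_mem_left (K := bergman n lam)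
      (show bergman n lam from g) (mulOp n lam a (bergmanIncl n lam f))
  rw [h1, L2.inner_def]
  apply integral_congr_ae
  filter_upwards [incl_ae_eq_holo f, incl_ae_eq_holo g,
    mulOp_ae_eq a (bergmanIncl n lam f)] with z h1 h2 h3
  rw [h3, h1, h2]
  rfl

/-! ### Adjoints -/

theorem star_toeplitz (a : Lp ℂ ∞ (vMeasure n lam)) :
    star (toeplitz n lam a) = toeplitz n lam (star a) := by
  rw [ContinuousLinearMap.star_eq_adjoint]
  symm
  rw [ContinuousLinearMap.eq_adjoint_iff]
  intro f g
  rw [inner_toeplitz, ← inner_conj_symm, inner_toeplitz, ← integral_conj]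
  apply integral_congr_ae
  filter_upwards [Lp.coeFn_star a] with z hz
  rw [hz]
  simp
  ring

theorem star_mem_invariantSymbols (H : Subgroup (K n)) {a : Lp ℂ ∞ (vMeasure n lam)}
    (ha : a ∈ invariantSymbols n lam H) : star a ∈ invariantSymbols n lam H := by
  intro h hh
  filter_upwards [ha h hh, Lp.coeFn_star a,
    (measurePreserving_act lam h⁻¹).quasiMeasurePreserving.ae (Lp.coeFn_star a)] with z h1 h2 h3
  rw [h2, h3, Pi.star_apply, Pi.star_apply, h1]

/-- The generating set is stable under adjoints, hence so is the algebra it generates, and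
continuity of the adjoint passes this to the closure. -/
theorem star_mem_toeplitzAlgebra (H : Subgroup (K n))
    {T : BergmanSpace n lam →L[ℂ] BergmanSpace n lam}
    (hT : T ∈ toeplitzAlgebra n lam (invariantSymbols n lam H)) :
    star T ∈ toeplitzAlgebra n lam (invariantSymbols n lam H) := by
  refine map_mem_closure continuous_star hT ?_
  intro T hT
  have h1 : star T ∈ star (Algebra.adjoin ℂ (toeplitz n lam '' invariantSymbols n lam H)) := by
    rw [Subalgebra.mem_star_iff, star_star]
    exact hT
  rw [Subalgebra.star_adjoin_comm] at h1
  refine Algebra.adjoin_mono ?_ h1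
  rintro S ⟨a, ha, hS⟩
  refine ⟨star a, star_mem_invariantSymbols H ha, ?_⟩
  rw [← star_toeplitz, hS, star_star]

theorem isCStarSubalgebra_toeplitzAlgebra (H : Subgroup (K n)) :
    IsCStarSubalgebra (toeplitzAlgebra n lam (invariantSymbols n lam H)) :=
  ⟨Subalgebra.isClosed_topologicalClosure _, fun _ hT => star_mem_toeplitzAlgebra H hT⟩

/-! ### The unitary representation of `SO(n) × SO(2)` -/

theorem comp_act_mem_bergman (g : K n) (f : BergmanSpace n lam) :
    Lp.compMeasurePreservingₗᵢ ℂ (act g⁻¹) (measurePreserving_act lam g⁻¹)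
      (bergmanIncl n lam f) ∈ bergman n lam :=
  ⟨holo f ∘ act g⁻¹, (differentiableOn_holo f).comp (differentiable_act _).differentiableOn
      fun _ hz => act_mem_domain _ hz,
    (Lp.coeFn_compMeasurePreserving _ (measurePreserving_act lam g⁻¹)).trans
      ((measurePreserving_act lam g⁻¹).quasiMeasurePreserving.ae_eq_comp (incl_ae_eq_holo f))⟩

/-- The operator `f ↦ f ∘ g⁻¹`. -/
def rotOp (lam : ℝ) (g : K n) : BergmanSpace n lam →ₗᵢ[ℂ] BergmanSpace n lam where
  toFun f := (⟨_, comp_act_mem_bergman g f⟩ : bergman n lam)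
  map_add' f h := Subtype.ext (by
    change Lp.compMeasurePreservingₗᵢ ℂ _ _ (bergmanIncl n lam (f + h)) = _
    rw [map_add, map_add]
    rfl)
  map_smul' c f := Subtype.ext (by
    change Lp.compMeasurePreservingₗᵢ ℂ _ _ (bergmanIncl n lam (c • f)) = _
    rw [map_smul, map_smul]
    rfl)
  norm_map' f := by
    change ‖Lp.compMeasurePreservingₗᵢ ℂ _ _ (bergmanIncl n lam f)‖ = _
    rw [LinearIsometry.norm_map, LinearIsometry.norm_map]

theorem incl_rotOp_ae_eq (g : K n) (f : BergmanSpace n lam) :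
    bergmanIncl n lam (rotOp lam g f) =ᵐ[vMeasure n lam] holo f ∘ act g⁻¹ :=
  (Lp.coeFn_compMeasurePreserving _ (measurePreserving_act lam g⁻¹)).trans
      ((measurePreserving_act lam g⁻¹).quasiMeasurePreserving.ae_eq_comp (incl_ae_eq_holo f))

theorem holo_rotOp_ae_eq (g : K n) (f : BergmanSpace n lam) :
    holo (rotOp lam g f) =ᵐ[vMeasure n lam] holo f ∘ act g⁻¹ :=
  (incl_ae_eq_holo _).symm.trans (incl_rotOp_ae_eq g f)

theorem holo_rotOp (hn : 2 ≤ n) (hlam : (n : ℝ) - 1 < lam) (g : K n) (f : BergmanSpace n lam) :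
    Set.EqOn (holo (rotOp lam g f)) (holo f ∘ act g⁻¹) (domain n) :=
  holo_eqOn hn hlam ((differentiableOn_holo f).continuousOn.comp
    (differentiable_act _).continuous.continuousOn fun _ hz => act_mem_domain _ hz)
    (incl_rotOp_ae_eq g f)

theorem rotOp_rotOp_inv (hn : 2 ≤ n) (hlam : (n : ℝ) - 1 < lam) (g : K n)
    (f : BergmanSpace n lam) : rotOp lam g (rotOp lam g⁻¹ f) = f := by
  apply eq_of_holo_eqOn
  intro z hz
  rw [holo_rotOp hn hlam g _ hz, Function.comp_apply,
    holo_rotOp hn hlam g⁻¹ f (act_mem_domain _ hz), Function.comp_apply, ← act_mul,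
    inv_inv, mul_inv_cancel, act_one]

theorem integral_comp_act (g : K n) (F : (Fin n → ℂ) → ℂ) :
    ∫ z, F (act g z) ∂vMeasure n lam = ∫ z, F z ∂vMeasure n lam :=
  (measurePreserving_act lam g).integral_comp
    (actEquiv g).toHomeomorph.measurableEmbedding F

/-- Substitution of `g⁻¹ z` in the integral for the matrix coefficients: the measure and the symbol
are both invariant. -/
theorem toeplitz_rotOp (hn : 2 ≤ n) (hlam : (n : ℝ) - 1 < lam) {H : Subgroup (K n)}
    {a : Lp ℂ ∞ (vMeasure n lam)} (ha : a ∈ invariantSymbols n lam H) {g : K n} (hg : g ∈ H)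
    (f : BergmanSpace n lam) :
    toeplitz n lam a (rotOp lam g f) = rotOp lam g (toeplitz n lam a f) := by
  refine ext_inner_left ℂ fun h => ?_
  -- Writing the test vector as a translate lets the isometry `rotOp lam g` cancel on the right-hand
  -- side.
  rw [← rotOp_rotOp_inv hn hlam g h]
  generalize rotOp lam g⁻¹ h = h
  rw [(rotOp lam g).inner_map_map, inner_toeplitz, inner_toeplitz,
    ← integral_comp_act g⁻¹ (fun z => a z * holo f z * star (holo h z))]
  apply integral_congr_ae
  filter_upwards [holo_rotOp_ae_eq g f, holo_rotOp_ae_eq g h, ha g hg] with z h1 h2 h3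
  rw [h1, h2, ← h3]
  rfl

/-! ### Conjugates in the orbits of `SO(n) × SO(2)` -/

/-- The reflection in the hyperplane orthogonal to `v`. -/
def reflMatrix (v : Fin n → ℝ) : Matrix (Fin n) (Fin n) ℝ :=
  1 - (2 / (v ⬝ᵥ v)) • vecMulVec v v

theorem reflMatrix_mulVec (v x : Fin n → ℝ) :
    reflMatrix v *ᵥ x = x - (2 / (v ⬝ᵥ v) * (v ⬝ᵥ x)) • v := by
  rw [reflMatrix, sub_mulVec, one_mulVec, smul_mulVec, vecMulVec_mulVec,
    op_smul_eq_smul, smul_smul]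

theorem reflMatrix_mul_transpose {v : Fin n → ℝ} (hv : v ⬝ᵥ v ≠ 0) :
    reflMatrix v * (reflMatrix v)ᵀ = 1 := by
  have h : vecMulVec v v * vecMulVec v v = (v ⬝ᵥ v) • vecMulVec v v := by
    rw [vecMulVec_mul_vecMulVec, vecMulVec_smul]
  simp only [reflMatrix, transpose_sub, transpose_one, transpose_smul, transpose_vecMulVec]
  rw [sub_mul, mul_sub, mul_sub, one_mul, mul_one, one_mul, smul_mul_smul_comm, h, smul_smul,
    ← sub_add, sub_sub, ← add_smul, sub_add, ← sub_smul]
  have : 2 / (v ⬝ᵥ v) + 2 / (v ⬝ᵥ v) - 2 / (v ⬝ᵥ v) * (2 / (v ⬝ᵥ v)) * (v ⬝ᵥ v) = 0 := by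
    field_simp
    ring
  rw [this, zero_smul, sub_zero]

theorem det_reflMatrix {v : Fin n → ℝ} (hv : v ⬝ᵥ v ≠ 0) : (reflMatrix v).det = -1 := by
  have h : reflMatrix v = 1 + replicateCol Unit (-(2 / (v ⬝ᵥ v)) • v) * replicateRow Unit v := by
    rw [reflMatrix, ← vecMulVec_eq, smul_vecMulVec, neg_smul, sub_eq_add_neg]
  rw [h, det_one_add_replicateCol_mul_replicateRow, dotProduct_smul, smul_eq_mul]
  field_simp
  ring

/-- Two linear conditions on a space of dimension at least three; the hypothesis `n ≥ 3` is needed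
here. -/
theorem exists_dotProduct_eq_zero (hn : 3 ≤ n) (x y : Fin n → ℝ) :
    ∃ e : Fin n → ℝ, e ⬝ᵥ e ≠ 0 ∧ e ⬝ᵥ x = 0 ∧ e ⬝ᵥ y = 0 := by
  set f : (Fin n → ℝ) →ₗ[ℝ] (Fin 2 → ℝ) := (Matrix.of ![x, y]).mulVecLin with hf
  have hk : LinearMap.ker f ≠ ⊥ := by
    apply LinearMap.ker_ne_bot_of_finrank_lt
    simp
    omega
  obtain ⟨e, he, he0⟩ := (Submodule.ne_bot_iff _).1 hk
  rw [LinearMap.mem_ker] at he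
  refine ⟨e, by simpa using he0, ?_, ?_⟩
  · have := congrFun he 0
    rw [dotProduct_comm]
    simpa [hf, mulVec] using this
  · have := congrFun he 1
    rw [dotProduct_comm]
    simpa [hf, mulVec] using this

/-- The reflection along `y` does the job but has determinant `-1`; a second reflection, along a
vector orthogonal to both `x` and `y`, corrects the sign without moving either. -/
theorem exists_SO_fix_neg (hn : 3 ≤ n) {x y : Fin n → ℝ} (hxy : y ⬝ᵥ x = 0) :
    ∃ A : SO n, A.1 *ᵥ x = x ∧ A.1 *ᵥ y = -y := by
  by_cases hy : y ⬝ᵥ y = 0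
  · refine ⟨1, by simp, ?_⟩
    have : y = 0 := by simpa using hy
    simp [this]
  obtain ⟨e, he, hex, hey⟩ := exists_dotProduct_eq_zero hn x y
  refine ⟨⟨reflMatrix e * reflMatrix y, mem_SO_iff.2 ⟨?_, ?_⟩⟩, ?_, ?_⟩
  · rw [transpose_mul, mul_assoc, ← mul_assoc (reflMatrix y), reflMatrix_mul_transpose hy, one_mul,
      reflMatrix_mul_transpose he]
  · rw [det_mul, det_reflMatrix he, det_reflMatrix hy]
    norm_num
  · change (reflMatrix e * reflMatrix y) *ᵥ x = x
    rw [← mulVec_mulVec, reflMatrix_mulVec y, hxy, mul_zero, zero_smul, sub_zero,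
      reflMatrix_mulVec, hex, mul_zero, zero_smul, sub_zero]
  · change (reflMatrix e * reflMatrix y) *ᵥ y = -y
    have h1 : reflMatrix y *ᵥ y = -y := by
      rw [reflMatrix_mulVec, div_mul_cancel₀ _ hy, two_smul]
      abel
    rw [← mulVec_mulVec, h1, mulVec_neg, reflMatrix_mulVec, hey, mul_zero, zero_smul, sub_zero]

theorem exists_circle_sq_mul (q : ℂ) : ∃ t : Circle, (t : ℂ) ^ 2 * q = ‖q‖ := by
  refine ⟨Circle.exp (-(q.arg / 2)), ?_⟩
  have hq := Complex.norm_mul_exp_arg_mul_I q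
  have h0 : ((2 : ℕ) : ℂ) * (((-(q.arg / 2) : ℝ) : ℂ) * Complex.I) + q.arg * Complex.I = 0 := by
    push_cast
    ring
  calc ((Circle.exp (-(q.arg / 2)) : Circle) : ℂ) ^ 2 * q
      = ((Circle.exp (-(q.arg / 2)) : Circle) : ℂ) ^ 2 * (‖q‖ * Complex.exp (q.arg * Complex.I)) := by
        rw [hq]
    _ = (‖q‖ : ℂ) := by
        rw [Circle.coe_exp, mul_left_comm, ← Complex.exp_nat_mul, ← Complex.exp_add, h0,
          Complex.exp_zero, mul_one]

/-- For `n ≥ 3`, the orbits of `SO(n) × SO(2)` are closed under complex conjugation. -/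
theorem exists_act_eq_star (hn : 3 ≤ n) (z : Fin n → ℂ) : ∃ g : K n, act g z = star z := by
  -- After a rotation making `wᵀw` real, the real and imaginary parts of `w = t z` are orthogonal.
  -- An element of `SO(n)` can then fix one and negate the other.
  obtain ⟨t, ht⟩ := exists_circle_sq_mul (z ⬝ᵥ z)
  set w : Fin n → ℂ := (t : ℂ) • z with hw
  have hww : w ⬝ᵥ w = ‖z ⬝ᵥ z‖ := by
    rw [← ht, hw, smul_dotProduct, dotProduct_smul, smul_smul, smul_eq_mul, sq]
  set x : Fin n → ℝ := fun i => (w i).re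
  set y : Fin n → ℝ := fun i => (w i).im
  have hxy : y ⬝ᵥ x = 0 := by
    have h := congrArg Complex.im hww
    simp only [dotProduct, Complex.im_sum, Complex.mul_im, Complex.ofReal_im] at h
    have h2 : ∑ i, ((w i).re * (w i).im + (w i).im * (w i).re) = 2 * (y ⬝ᵥ x) := by
      simp only [dotProduct, Finset.mul_sum, x, y]
      exact Finset.sum_congr rfl fun i _ => by ring
    linarith
  obtain ⟨A, hA1, hA2⟩ := exists_SO_fix_neg hn hxy
  have hAw : A.1.map ((↑) : ℝ → ℂ) *ᵥ w = star w := by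
    ext i
    have e1 := congrFun hA1 i
    have e2 := congrFun hA2 i
    simp only [mulVec, dotProduct, Pi.neg_apply, x, y] at e1 e2
    apply Complex.ext
    · simpa [mulVec, dotProduct] using e1
    · simpa [mulVec, dotProduct] using e2
  -- One factor `t` forms `w = t z`; the other cancels the `conj t` in `A w = conj w = conj t · conj
  -- z`.
  refine ⟨(A, t * t), ?_⟩
  have h1 : act (A, t * t) z = (t : ℂ) • (A.1.map ((↑) : ℝ → ℂ) *ᵥ w) := by
    simp only [act, hw, mulVec_smul, smul_smul, Circle.coe_mul]
  have h2 : (t : ℂ) * (starRingEnd ℂ) (t : ℂ) = 1 := by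
    have ht1 : ‖(t : ℂ)‖ = 1 := Circle.norm_coe t
    rw [Complex.mul_conj', ht1]
    simp
  rw [h1, hAw, hw, star_smul, smul_smul]
  change ((t : ℂ) * (starRingEnd ℂ) (t : ℂ)) • _ = _
  rw [h2, one_smul]

/-! ### Weakly holomorphic maps -/

/-- A bounded weakly holomorphic map into a Hilbert space is differentiable. -/
theorem differentiableAt_of_weakly {H : Type*} [NormedAddCommGroup H] [InnerProductSpace ℂ H]
    [CompleteSpace H] {φ : ℂ → H} {s₀ : ℂ} {R M : ℝ} (hR : 0 < R)
    (hb : ∀ s ∈ Metric.ball s₀ R, ‖φ s‖ ≤ M)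
    (hd : ∀ f, DifferentiableOn ℂ (fun s => ⟪f, φ s⟫_ℂ) (Metric.ball s₀ R)) :
    DifferentiableAt ℂ φ s₀ := by
  have hs₀ : s₀ ∈ Metric.ball s₀ R := Metric.mem_ball_self hR
  have hM : 0 ≤ M := (norm_nonneg _).trans (hb s₀ hs₀)
  have hbf : ∀ f, ∀ s ∈ Metric.ball s₀ R, ‖⟪f, φ s⟫_ℂ‖ ≤ M * ‖f‖ := fun f s hs =>
    (norm_inner_le_norm f (φ s)).trans (by
      rw [mul_comm]
      exact mul_le_mul_of_nonneg_right (hb s hs) (norm_nonneg f))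
  -- The slopes converge weakly at a linear rate that depends on `f` only through its norm; this
  -- uniformity upgrades weak to strong convergence.
  have key : ∀ f, ∀ s ∈ Metric.ball s₀ R, s ≠ s₀ →
      ‖⟪f, slope φ s₀ s⟫_ℂ - deriv (fun s => ⟪f, φ s⟫_ℂ) s₀‖ ≤
        4 * M / R ^ 2 * ‖s - s₀‖ * ‖f‖ := by
    intro f s hs hne
    set g : ℂ → ℂ := fun s => ⟪f, φ s⟫_ℂ with hg
    set d := deriv g s₀
    have hgd : HasDerivAt g d s₀ :=
      ((hd f).differentiableAt (Metric.ball_mem_nhds s₀ hR)).hasDerivAt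
    have hdn : ‖d‖ ≤ 2 * (M * ‖f‖) / R := by
      rw [norm_deriv_eq_norm_fderiv]
      exact fderiv_norm_le hR (hd f) (hbf f)
    -- `h - h s₀` vanishes to second order at `s₀`, so a higher order Schwarz lemma bounds it
    -- quadratically. The bound `4 M ‖f‖` is `M ‖f‖` for each of the two values of `g` plus `2 M
    -- ‖f‖` for the linear term.
    set h : ℂ → ℂ := fun s => g s - (s - s₀) * d with hh
    have hh0 : h s₀ = g s₀ := by simp [hh]
    have h1 := Complex.dist_le_mul_div_pow_of_mapsTo_ball_of_isLittleO (f := h) (c := s₀) (z := s)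
      (R₁ := R) (R₂ := 4 * (M * ‖f‖)) (n := 1) ?_ ?_ ?_ hs
    · rw [dist_eq_norm, dist_eq_norm, hh0] at h1
      have h2 : ⟪f, slope φ s₀ s⟫_ℂ - d = (s - s₀)⁻¹ * (h s - g s₀) := by
        have : s - s₀ ≠ 0 := sub_ne_zero.2 hne
        rw [slope_def_module, inner_smul_right, inner_sub_right, hh]
        field_simp
        ring
      have h3 : 0 < ‖s - s₀‖ := norm_pos_iff.2 (sub_ne_zero.2 hne)
      rw [h2, norm_mul, norm_inv, inv_mul_le_iff₀ h3]
      refine h1.trans (le_of_eq ?_)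
      rw [div_pow]
      field_simp
      ring
    · exact (hd f).sub (by fun_prop)
    · intro s hs
      rw [Metric.mem_closedBall, dist_eq_norm, hh0]
      have h1 := hbf f s hs
      have h2 := hbf f s₀ hs₀
      have h3 : ‖(s - s₀) * d‖ ≤ 2 * (M * ‖f‖) := by
        rw [norm_mul]
        rw [Metric.mem_ball, dist_eq_norm] at hs
        calc ‖s - s₀‖ * ‖d‖ ≤ R * (2 * (M * ‖f‖) / R) := by gcongr
          _ = _ := by field_simp
      calc ‖g s - (s - s₀) * d - g s₀‖ ≤ ‖g s - (s - s₀) * d‖ + ‖g s₀‖ := norm_sub_le _ _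
        _ ≤ ‖g s‖ + ‖(s - s₀) * d‖ + ‖g s₀‖ := by gcongr; exact norm_sub_le _ _
        _ ≤ _ := by linarith
    · have h1 := hasDerivAt_iff_isLittleO.1 hgd
      simp only [pow_one]
      refine Asymptotics.IsLittleO.norm_right (h1.congr_left fun s => ?_)
      simp [hh]
      ring
  -- The estimate is tested on `f` equal to the difference of the two slopes itself, which bounds
  -- its norm.
  have key2 : ∀ s ∈ Metric.ball s₀ R, s ≠ s₀ → ∀ s' ∈ Metric.ball s₀ R, s' ≠ s₀ →
      ‖slope φ s₀ s - slope φ s₀ s'‖ ≤ 4 * M / R ^ 2 * (‖s - s₀‖ + ‖s' - s₀‖) := by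
    intro s hs hne s' hs' hne'
    set f := slope φ s₀ s - slope φ s₀ s' with hf
    have h1 := key f s hs hne
    have h2 := key f s' hs' hne'
    have h3 : ‖f‖ * ‖f‖ ≤ 4 * M / R ^ 2 * (‖s - s₀‖ + ‖s' - s₀‖) * ‖f‖ := by
      have h4 : ‖f‖ * ‖f‖ = ‖⟪f, f⟫_ℂ‖ := by
        rw [inner_self_eq_norm_sq_to_K]
        simp [sq]
      rw [h4]
      have h5 : ⟪f, f⟫_ℂ = (⟪f, slope φ s₀ s⟫_ℂ - deriv (fun s => ⟪f, φ s⟫_ℂ) s₀) -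
          (⟪f, slope φ s₀ s'⟫_ℂ - deriv (fun s => ⟪f, φ s⟫_ℂ) s₀) := by
        conv_lhs => rw [hf, inner_sub_right]
        ring
      rw [h5]
      refine (norm_sub_le _ _).trans ?_
      linarith
    by_cases h0 : ‖f‖ = 0
    · rw [h0]; positivity
    · exact le_of_mul_le_mul_right h3 (lt_of_le_of_ne (norm_nonneg f) (Ne.symm h0))
  have hc : Cauchy (Filter.map (slope φ s₀) (nhdsWithin s₀ {s₀}ᶜ)) := by
    rw [Metric.cauchy_iff]
    refine ⟨inferInstance, fun ε hε => ?_⟩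
    set δ := min R (ε / (2 * (4 * M / R ^ 2 + 1))) with hδ
    have hC : 0 ≤ 4 * M / R ^ 2 := by positivity
    have hδ0 : 0 < δ := lt_min hR (by positivity)
    have hδ1 : 2 * (4 * M / R ^ 2 + 1) * δ ≤ ε := by
      have : δ ≤ ε / (2 * (4 * M / R ^ 2 + 1)) := min_le_right _ _
      rwa [le_div_iff₀ (by positivity), mul_comm] at this
    refine ⟨slope φ s₀ '' (Metric.ball s₀ δ ∩ {s₀}ᶜ), Filter.image_mem_map
      (Filter.inter_mem (mem_nhdsWithin_of_mem_nhds (Metric.ball_mem_nhds _ hδ0))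
        self_mem_nhdsWithin), ?_⟩
    rintro _ ⟨s, ⟨hs, hne⟩, rfl⟩ _ ⟨s', ⟨hs', hne'⟩, rfl⟩
    have hsub : Metric.ball s₀ δ ⊆ Metric.ball s₀ R := Metric.ball_subset_ball (min_le_left _ _)
    rw [dist_eq_norm]
    refine (key2 s (hsub hs) hne s' (hsub hs') hne').trans_lt ?_
    rw [Metric.mem_ball, dist_eq_norm] at hs hs'
    nlinarith
  obtain ⟨v, hv⟩ := CompleteSpace.complete hc
  exact (hasDerivAt_iff_tendsto_slope.2 hv).differentiableAt

/-! ### The identity theorem on the domain -/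

/-- On the line `c ↦ c • z` the parameters landing in the domain form a set star-shaped about `0`,
because the domain is balanced. The one-variable identity theorem then reaches `c = 1`. -/
theorem eq_of_holo_eventuallyEq {f g : BergmanSpace n lam} (h : holo f =ᶠ[nhds 0] holo g) :
    f = g := by
  apply eq_of_holo_eqOn
  intro z hz
  set U : Set ℂ := {c | c • z ∈ domain n} with hU
  have hUo : IsOpen U := (isOpen_domain n).preimage (by fun_prop)
  have h0 : (0 : ℂ) ∈ U := by simp [hU, zero_mem_domain]
  have hUp : IsPreconnected U := by
    refine (StarConvex.isPathConnected (a := 0) ?_ h0).isConnected.isPreconnected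
    rw [starConvex_zero_iff]
    intro c hc t ht0 ht1
    change (t • c) • z ∈ domain n
    rw [Complex.real_smul, mul_smul]
    exact smul_mem_domain hc (by simpa [abs_of_nonneg ht0] using ht1)
  have hd : ∀ f : BergmanSpace n lam, AnalyticOnNhd ℂ (fun c : ℂ => holo f (c • z)) U := by
    intro f
    refine DifferentiableOn.analyticOnNhd ?_ hUo
    exact (differentiableOn_holo f).comp (by fun_prop) fun c hc => hc
  have hev : (fun c : ℂ => holo f (c • z)) =ᶠ[nhds 0] fun c => holo g (c • z) := by
    have ht : Filter.Tendsto (fun c : ℂ => c • z) (nhds 0) (nhds 0) := by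
      have : Continuous fun c : ℂ => c • z := by fun_prop
      simpa using this.tendsto 0
    exact ht.eventually h
  have := (hd f).eqOn_of_preconnected_of_eventuallyEq (hd g) hUp h0 hev
    (show (1 : ℂ) ∈ U by simpa [hU] using hz)
  simpa using this

/-! ### The reproducing kernel -/

/-- The mean value inequality gives a locally uniform bound on point evaluations. It yields the
kernel by Riesz representation, and the local boundedness of the kernel. -/
theorem exists_norm_holo_le (hn : 2 ≤ n) (hlam : (n : ℝ) - 1 < lam) {z₀ : Fin n → ℂ}
    (hz₀ : z₀ ∈ domain n) : ∃ R C : ℝ, 0 < R ∧ 0 ≤ C ∧ Metric.closedBall z₀ R ⊆ domain n ∧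
      ∀ f : BergmanSpace n lam, ∀ z ∈ Metric.closedBall z₀ R, ‖holo f z‖ ≤ C * ‖f‖ := by
  obtain ⟨R, hR, hsub⟩ := Metric.nhds_basis_closedBall.mem_iff.1 ((isOpen_domain n).mem_nhds hz₀)
  obtain ⟨ε, hε, hε', hle⟩ := exists_smul_restrict_le_vMeasure hn hlam hR.le hsub
  obtain ⟨C, hC, hb⟩ := norm_le_of_aeEq (isOpen_domain n) hR hε hε' hsub hle
  refine ⟨R / 2, C, half_pos hR, hC,
    (Metric.closedBall_subset_closedBall (by linarith)).trans hsub, fun f z hz => ?_⟩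
  have := hb (holo f) (bergmanIncl n lam f) (differentiableOn_holo f) (incl_ae_eq_holo f) z hz
  rwa [LinearIsometry.norm_map] at this

/-- `k z` represents the evaluation at `z`. -/
def IsReproducingKernel (k : (Fin n → ℂ) → BergmanSpace n lam) : Prop :=
  ∀ z ∈ domain n, ∀ f, ⟪k z, f⟫_ℂ = holo f z

theorem exists_isReproducingKernel (hn : 2 ≤ n) (hlam : (n : ℝ) - 1 < lam) :
    ∃ k : (Fin n → ℂ) → BergmanSpace n lam, IsReproducingKernel k := by
  have : ∀ z, ∃ k : BergmanSpace n lam, z ∈ domain n → ∀ f, ⟪k, f⟫_ℂ = holo f z := by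
    intro z
    by_cases hz : z ∈ domain n
    swap
    · exact ⟨0, fun h => absurd h hz⟩
    obtain ⟨R, C, hR, hC, -, hb⟩ := exists_norm_holo_le hn hlam hz
    set ℓ : BergmanSpace n lam →L[ℂ] ℂ := LinearMap.mkContinuous
      { toFun := fun f => holo f z
        map_add' := fun f g => holo_add hn hlam f g hz
        map_smul' := fun c f => holo_smul hn hlam c f hz } C
      (fun f => hb f z (Metric.mem_closedBall_self hR.le))
    refine ⟨(InnerProductSpace.toDual ℂ _).symm ℓ, fun _ f => ?_⟩
    rw [InnerProductSpace.toDual_symm_apply]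
    rfl
  choose k hk using this
  exact ⟨k, fun z => hk z⟩

/-! ### Complex conjugation on the Bergman space -/

theorem differentiableOn_conj (f : BergmanSpace n lam) :
    DifferentiableOn ℂ (fun z => star (holo f (star z))) (domain n) := by
  intro z hz
  have h := (differentiableOn_holo f).differentiableAt
    ((isOpen_domain n).mem_nhds (star_mem_domain hz))
  have h2 := h.star_star
  rw [star_star] at h2
  exact h2.differentiableWithinAt

theorem memLp_conj (f : BergmanSpace n lam) :
    MemLp (fun z => star (holo f (star z))) 2 (vMeasure n lam) :=
  ((memLp_holo f).comp_measurePreserving (measurePreserving_star lam)).star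

/-- `f ↦ conj (f (conj z))`. -/
def conjFun (f : BergmanSpace n lam) : BergmanSpace n lam :=
  mkBergman (fun z => star (holo f (star z))) (differentiableOn_conj f) (memLp_conj f)

theorem holo_conjFun_ae_eq (f : BergmanSpace n lam) :
    holo (conjFun f) =ᵐ[vMeasure n lam] fun z => star (holo f (star z)) :=
  (incl_ae_eq_holo _).symm.trans (memLp_conj f).coeFn_toLp

theorem holo_conjFun (hn : 2 ≤ n) (hlam : (n : ℝ) - 1 < lam) (f : BergmanSpace n lam)
    {z : Fin n → ℂ} (hz : z ∈ domain n) : holo (conjFun f) z = star (holo f (star z)) :=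
  holo_mkBergman hn hlam _ _ _ hz

theorem integral_comp_star (F : (Fin n → ℂ) → ℂ) :
    ∫ z, F (star z) ∂vMeasure n lam = ∫ z, F z ∂vMeasure n lam :=
  (measurePreserving_star lam).integral_comp
    (starL' ℝ (A := Fin n → ℂ)).toHomeomorph.measurableEmbedding F

theorem inner_conjFun_conjFun (f g : BergmanSpace n lam) :
    ⟪conjFun f, conjFun g⟫_ℂ = ⟪g, f⟫_ℂ := by
  rw [inner_eq_integral, inner_eq_integral,
    ← integral_comp_star (fun z => holo f z * star (holo g z))]
  apply integral_congr_ae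
  filter_upwards [holo_conjFun_ae_eq f, holo_conjFun_ae_eq g] with z h1 h2
  rw [h1, h2, star_star, mul_comm]

/-- The antilinear isometry `f ↦ conj (f (conj z))`. -/
def conjOp (hn : 2 ≤ n) (hlam : (n : ℝ) - 1 < lam) :
    BergmanSpace n lam →ₛₗᵢ[starRingEnd ℂ] BergmanSpace n lam where
  toFun := conjFun
  map_add' f g := eq_of_holo_eqOn fun z hz => by
    rw [holo_conjFun hn hlam _ hz, holo_add hn hlam _ _ (star_mem_domain hz),
      holo_add hn hlam _ _ hz, Pi.add_apply, Pi.add_apply, holo_conjFun hn hlam _ hz,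
      holo_conjFun hn hlam _ hz, star_add]
  map_smul' c f := eq_of_holo_eqOn fun z hz => by
    rw [holo_conjFun hn hlam _ hz, holo_smul hn hlam _ _ (star_mem_domain hz),
      holo_smul hn hlam _ _ hz, Pi.smul_apply, Pi.smul_apply, holo_conjFun hn hlam _ hz,
      star_smul]
    rfl
  norm_map' f := by
    change ‖conjFun f‖ = ‖f‖
    rw [@norm_eq_sqrt_re_inner ℂ, @norm_eq_sqrt_re_inner ℂ _ _ _ _ f, inner_conjFun_conjFun]

theorem inner_conjOp_conjOp (hn : 2 ≤ n) (hlam : (n : ℝ) - 1 < lam)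
    (f g : BergmanSpace n lam) :
    ⟪conjOp hn hlam f, conjOp hn hlam g⟫_ℂ = ⟪g, f⟫_ℂ := inner_conjFun_conjFun f g

theorem holo_conjOp (hn : 2 ≤ n) (hlam : (n : ℝ) - 1 < lam)
    (f : BergmanSpace n lam) {z : Fin n → ℂ} (hz : z ∈ domain n) :
    holo (conjOp hn hlam f) z = star (holo f (star z)) := holo_conjFun hn hlam f hz

theorem conjOp_conjOp (hn : 2 ≤ n) (hlam : (n : ℝ) - 1 < lam)
    (f : BergmanSpace n lam) : conjOp hn hlam (conjOp hn hlam f) = f :=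
  eq_of_holo_eqOn fun z hz => by
    rw [holo_conjOp hn hlam _ hz, holo_conjOp hn hlam _ (star_mem_domain hz), star_star, star_star]

/-- The complex bilinear form `⟪J f, g⟫` is symmetric, as `J` is antiunitary with `J² = 1`. -/
theorem inner_conjOp_left (hn : 2 ≤ n) (hlam : (n : ℝ) - 1 < lam)
    (f g : BergmanSpace n lam) :
    ⟪conjOp hn hlam f, g⟫_ℂ = ⟪conjOp hn hlam g, f⟫_ℂ := by
  rw [← inner_conjOp_conjOp hn hlam, conjOp_conjOp]

variable {k : (Fin n → ℂ) → BergmanSpace n lam}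

theorem norm_kernel_le (hk : IsReproducingKernel k) {z : Fin n → ℂ} (hz : z ∈ domain n) {C : ℝ}
    (hC0 : 0 ≤ C) (hC : ∀ f : BergmanSpace n lam, ‖holo f z‖ ≤ C * ‖f‖) : ‖k z‖ ≤ C := by
  have h1 := hC (k z)
  rw [← hk z hz, inner_self_eq_norm_sq_to_K] at h1
  simp only [Complex.coe_algebraMap, norm_pow, Complex.norm_real, norm_norm] at h1
  by_cases h0 : ‖k z‖ = 0
  · rw [h0]
    exact hC0
  · nlinarith [lt_of_le_of_ne (norm_nonneg (k z)) (Ne.symm h0)]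

theorem kernel_star (hn : 2 ≤ n) (hlam : (n : ℝ) - 1 < lam)
    (hk : IsReproducingKernel k) {z : Fin n → ℂ} (hz : z ∈ domain n) :
    k (star z) = conjOp hn hlam (k z) := by
  refine ext_inner_right ℂ fun f => ?_
  rw [hk _ (star_mem_domain hz), inner_conjOp_left, ← inner_conj_symm, hk z hz,
    holo_conjOp hn hlam f hz]
  exact (star_star _).symm

/-- Evaluation at `g z` is evaluation at `z` after the unitary `rotOp lam g⁻¹`, and the representing
vector is unique. -/
theorem rotOp_kernel (hn : 2 ≤ n) (hlam : (n : ℝ) - 1 < lam)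
    (hk : IsReproducingKernel k) (g : K n) {z : Fin n → ℂ} (hz : z ∈ domain n) :
    rotOp lam g (k z) = k (act g z) := by
  refine ext_inner_right ℂ fun f => ?_
  rw [hk _ (act_mem_domain g hz), ← rotOp_rotOp_inv hn hlam g f, (rotOp lam g).inner_map_map,
    hk z hz, rotOp_rotOp_inv hn hlam g f, holo_rotOp hn hlam g⁻¹ f hz, Function.comp_apply, inv_inv]

/-- The kernel is antiholomorphic in its parameter, so composing with the antilinear `J` makes it
holomorphic: `⟪f, J (k z)⟫ = (J f) z`. Local boundedness turns weak into strong differentiability.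
-/
theorem differentiableAt_conjOp_kernel (hn : 2 ≤ n) (hlam : (n : ℝ) - 1 < lam)
    (hk : IsReproducingKernel k) {a b : Fin n → ℂ} {s₀ : ℂ}
    (hs₀ : a + s₀ • b ∈ domain n) :
    DifferentiableAt ℂ (fun s : ℂ => conjOp hn hlam (k (a + s • b))) s₀ := by
  obtain ⟨R, C, hR, hC, hsub, hb⟩ := exists_norm_holo_le hn hlam hs₀
  have hc : ContinuousAt (fun s : ℂ => a + s • b) s₀ := by fun_prop
  obtain ⟨r, hr, hball⟩ := Metric.mem_nhds_iff.1
    (hc.preimage_mem_nhds (Metric.closedBall_mem_nhds _ hR))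
  refine differentiableAt_of_weakly hr (M := C) ?_ ?_
  · intro s hs
    rw [LinearIsometry.norm_map]
    exact norm_kernel_le hk (hsub (hball hs)) hC fun f => hb f _ (hball hs)
  · intro f
    have h1 : Set.EqOn (fun s : ℂ => ⟪f, conjOp hn hlam (k (a + s • b))⟫_ℂ)
        (fun s => holo (conjOp hn hlam f) (a + s • b)) (Metric.ball s₀ r) := by
      intro s hs
      change ⟪f, conjOp hn hlam (k (a + s • b))⟫_ℂ = _
      change _ = holo (conjOp hn hlam f) (a + s • b)
      rw [← hk _ (hsub (hball hs)), ← inner_conj_symm, inner_conjOp_left, inner_conj_symm]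
    refine DifferentiableOn.congr ?_ h1
    exact (differentiableOn_holo _).comp (by fun_prop) fun s hs => hsub (hball hs)

/-- The diagonal of the kernel of an invariant operator is invariant under conjugation. -/
theorem inner_kernel_star (hn : 2 ≤ n) (hlam : (n : ℝ) - 1 < lam)
    (hn3 : 3 ≤ n) (hk : IsReproducingKernel k)
    {S : BergmanSpace n lam →L[ℂ] BergmanSpace n lam}
    (hS : ∀ g f, S (rotOp lam g f) = rotOp lam g (S f)) {z : Fin n → ℂ} (hz : z ∈ domain n) :
    ⟪k (star z), S (k (star z))⟫_ℂ = ⟪k z, S (k z)⟫_ℂ := by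
  obtain ⟨g, hg⟩ := exists_act_eq_star hn3 z
  rw [← hg, ← rotOp_kernel hn hlam hk g hz, hS, (rotOp lam g).inner_map_map]

/-- Polarization of `inner_kernel_star`. -/
theorem exists_inner_kernel_symm (hn : 2 ≤ n) (hlam : (n : ℝ) - 1 < lam)
    (hn3 : 3 ≤ n) (hk : IsReproducingKernel k)
    {S : BergmanSpace n lam →L[ℂ] BergmanSpace n lam}
    (hS : ∀ g f, S (rotOp lam g f) = rotOp lam g (S f)) :
    ∃ r : ℝ, 0 < r ∧ Metric.ball 0 r ⊆ domain n ∧ ∀ u ∈ Metric.ball (0 : Fin n → ℂ) r,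
      ∀ w ∈ Metric.ball (0 : Fin n → ℂ) r,
        ⟪k u, S (conjOp hn hlam (k w))⟫_ℂ = ⟪k w, S (conjOp hn hlam (k u))⟫_ℂ := by
  obtain ⟨R, hR, hball⟩ := Metric.isOpen_iff.1 (isOpen_domain n) 0 (zero_mem_domain n)
  refine ⟨R / 3, by positivity, (Metric.ball_subset_ball (by linarith)).trans hball, ?_⟩
  intro u hu w hw
  rw [mem_ball_zero_iff] at hu hw
  set J := conjOp (lam := lam) hn hlam
  -- The complexified segment is chosen so that at `s = i` the points `a + s b` and `conj a + s conj
  -- b` are `w` and `u`, while for real `s` they are conjugate to each other. Since `R / 3 + 2 · R /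
  -- 3 = R`, both stay in the domain for `|s| < 2`.
  set a : Fin n → ℂ := (2⁻¹ : ℂ) • (w + star u) with ha
  set b : Fin n → ℂ := (-Complex.I / 2) • (w - star u) with hb
  have han : ‖a‖ < R / 3 := by
    rw [ha, norm_smul]
    have := norm_add_le w (star u)
    rw [norm_star] at this
    norm_num
    linarith
  have hbn : ‖b‖ < R / 3 := by
    rw [hb, norm_smul]
    have := norm_sub_le w (star u)
    rw [norm_star] at this
    norm_num
    linarith
  have hmem : ∀ a b : Fin n → ℂ, ‖a‖ < R / 3 → ‖b‖ < R / 3 → ∀ s ∈ Metric.ball (0 : ℂ) 2,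
      a + s • b ∈ domain n := by
    intro a b han hbn s hs
    apply hball
    rw [mem_ball_zero_iff] at hs ⊢
    have h1 := norm_add_le a (s • b)
    rw [norm_smul] at h1
    nlinarith [norm_nonneg b, norm_nonneg s]
  have hp := hmem a b han hbn
  have hp' := hmem (star a) (star b) (by rwa [norm_star]) (by rwa [norm_star])
  have hJJ : ∀ f, J (J f) = f := conjOp_conjOp hn hlam
  set B : BergmanSpace n lam →L[ℂ] BergmanSpace n lam →L[ℂ] ℂ :=
    (innerSL ℂ).comp J.toContinuousLinearMap with hB
  have hBa : ∀ x y, B x y = ⟪J x, y⟫_ℂ := fun x y => rfl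
  -- `B` is complex bilinear and every argument is a holomorphic `J (k _)`, so `φ` is holomorphic.
  -- For real `s` it is the difference of the two diagonal values at `conj z` and `z`; at `s = i` it
  -- is the difference to be shown zero.
  set φ : ℂ → ℂ := fun s => B (J (k (star a + s • star b))) (S (J (k (a + s • b)))) -
    B (J (k (a + s • b))) (S (J (k (star a + s • star b)))) with hφ
  have hφd : AnalyticOnNhd ℂ φ (Metric.ball 0 2) := by
    refine DifferentiableOn.analyticOnNhd ?_ Metric.isOpen_ball
    intro s hs
    have h1 : DifferentiableAt ℂ (fun s : ℂ => J (k (a + s • b))) s :=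
      differentiableAt_conjOp_kernel hn hlam hk (hp s hs)
    have h2 : DifferentiableAt ℂ (fun s : ℂ => J (k (star a + s • star b))) s :=
      differentiableAt_conjOp_kernel hn hlam hk (hp' s hs)
    apply DifferentiableAt.differentiableWithinAt
    exact ((B.differentiableAt.comp s h2).clm_apply (S.differentiableAt.comp s h1)).sub
      ((B.differentiableAt.comp s h1).clm_apply (S.differentiableAt.comp s h2))
  have hφ0 : ∀ s : ℝ, (s : ℂ) ∈ Metric.ball (0 : ℂ) 2 → φ s = 0 := by
    intro s hs
    have h1 : star (a + (s : ℂ) • b) = star a + (s : ℂ) • star b := by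
      rw [star_add, star_smul]
      congr 2
      simp
    have h2 := kernel_star hn hlam hk (hp s hs)
    rw [h1] at h2
    have h3 := inner_kernel_star hn hlam hn3 hk hS (hp s hs)
    rw [h1] at h3
    simp only [hφ, hBa, hJJ]
    change k (star a + (s : ℂ) • star b) = J (k (a + (s : ℂ) • b)) at h2
    rw [← h2, h3]
    rw [h2, hJJ, sub_self]
  have hfreq : ∃ᶠ s in nhdsWithin (0 : ℂ) {0}ᶜ, φ s = 0 := by
    have ht : Filter.Tendsto ((↑) : ℝ → ℂ) (nhdsWithin 0 {0}ᶜ) (nhdsWithin 0 {0}ᶜ) := by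
      refine tendsto_nhdsWithin_iff.2 ⟨?_, ?_⟩
      · have := Complex.continuous_ofReal.tendsto 0
        rw [Complex.ofReal_zero] at this
        exact this.mono_left nhdsWithin_le_nhds
      · filter_upwards [self_mem_nhdsWithin] with s hs
        simpa using hs
    refine ht.frequently (Filter.Eventually.frequently ?_)
    have hnb := ht.eventually (mem_nhdsWithin_of_mem_nhds
      (Metric.ball_mem_nhds (0 : ℂ) two_pos))
    exact hnb.mono fun s hs => hφ0 s hs
  have h0 := hφd.eqOn_zero_of_preconnected_of_frequently_eq_zero
    (convex_ball 0 2).isPreconnected (Metric.mem_ball_self two_pos) hfreq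
    (show Complex.I ∈ Metric.ball (0 : ℂ) 2 by simp)
  have hw : a + Complex.I • b = w := by
    rw [ha, hb, smul_smul]
    have : Complex.I * (-Complex.I / 2) = 2⁻¹ := by
      rw [mul_div_assoc', mul_neg, Complex.I_mul_I, neg_neg, one_div]
    rw [this, ← smul_add, add_add_sub_cancel, ← two_smul ℂ w, smul_smul]
    norm_num
  have hu : star a + Complex.I • star b = u := by
    have : star (-Complex.I / 2) = Complex.I / 2 := by simp
    rw [ha, hb, star_smul, star_smul, this, smul_smul, mul_div_assoc', Complex.I_mul_I, star_add,
      star_sub, star_star]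
    have : star (2⁻¹ : ℂ) = 2⁻¹ := by simp
    rw [this]
    have : (-1 / 2 : ℂ) = - 2⁻¹ := by norm_num
    rw [this, neg_smul, ← sub_eq_add_neg, ← smul_sub, add_sub_sub_cancel, ← two_smul ℂ u,
      smul_smul]
    norm_num
  simp only [hφ, hBa, hJJ, hw, hu, Pi.zero_apply] at h0
  exact sub_eq_zero.1 h0

/-- An operator that commutes with `SO(n) × SO(2)` is symmetric for the bilinear form
`⟪conj h, f⟫`. -/
theorem eq_conj_adjoint (hn : 2 ≤ n) (hlam : (n : ℝ) - 1 < lam)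
    (hn3 : 3 ≤ n) {S : BergmanSpace n lam →L[ℂ] BergmanSpace n lam}
    (hS : ∀ g f, S (rotOp lam g f) = rotOp lam g (S f)) (f : BergmanSpace n lam) :
    S f = conjOp hn hlam (star S (conjOp hn hlam f)) := by
  obtain ⟨k, hk⟩ := exists_isReproducingKernel hn hlam
  obtain ⟨r, hr, hball, hsym⟩ := exists_inner_kernel_symm hn hlam hn3 hk hS
  set J := conjOp (lam := lam) hn hlam
  have hJJ : ∀ f, J (J f) = f := conjOp_conjOp hn hlam
  have hJl : ∀ f g, ⟪J f, g⟫_ℂ = ⟪J g, f⟫_ℂ := inner_conjOp_left hn hlam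
  have hadj : ∀ f g, ⟪f, star S g⟫_ℂ = ⟪S f, g⟫_ℂ := fun f g =>
    ContinuousLinearMap.adjoint_inner_right S f g
  have hev : ∀ᶠ z in nhds (0 : Fin n → ℂ), z ∈ Metric.ball (0 : Fin n → ℂ) r :=
    Metric.ball_mem_nhds _ hr
  -- Equality of `J S J` and `S*` on kernels near the origin: evaluated at a nearby `z`, it is the
  -- symmetry `hsym` at `conj z` and `w`.
  have hker : ∀ w ∈ Metric.ball (0 : Fin n → ℂ) r, J (S (J (k w))) = star S (k w) := by
    intro w hw
    apply eq_of_holo_eventuallyEq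
    filter_upwards [hev] with z hz
    have hz' : star z ∈ Metric.ball (0 : Fin n → ℂ) r := by
      rw [mem_ball_zero_iff] at hz ⊢
      rwa [norm_star]
    have hkz : k z = J (k (star z)) := by
      have := kernel_star hn hlam hk (star_mem_domain (hball hz))
      rwa [star_star] at this
    rw [← hk z (hball hz), ← hk z (hball hz), hadj, hkz, hJl, hJJ, ← inner_conj_symm,
      hsym _ hz' w hw, inner_conj_symm]
  apply eq_of_holo_eventuallyEq
  filter_upwards [hev] with w hw
  rw [← hk w (hball hw), ← hk w (hball hw)]
  have h1 : ⟪k w, S f⟫_ℂ = ⟪star S (k w), f⟫_ℂ := by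
    rw [← inner_conj_symm, ← hadj, inner_conj_symm]
  rw [h1, ← hker w hw, hJl, ← inner_conj_symm, ← hadj, inner_conj_symm,
    ← inner_conjOp_conjOp hn hlam]
  change ⟪J (J (k w)), _⟫_ℂ = _
  rw [hJJ]

/-- Two operators that commute with `SO(n) × SO(2)` commute. -/
theorem mul_comm_of_commute_rotOp (hn : 2 ≤ n) (hlam : (n : ℝ) - 1 < lam)
    (hn3 : 3 ≤ n)
    {S T : BergmanSpace n lam →L[ℂ] BergmanSpace n lam}
    (hS : ∀ g f, S (rotOp lam g f) = rotOp lam g (S f))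
    (hT : ∀ g f, T (rotOp lam g f) = rotOp lam g (T f)) : S * T = T * S := by
  ext1 f
  have hST : ∀ g f, (S * T) (rotOp lam g f) = rotOp lam g ((S * T) f) := fun g f => by
    rw [mul_apply_eq_comp, hT, hS]
    rfl
  -- The product `S T` is symmetric too, so `S T = J T* S* J`, and inserting `J J = 1` in the middle
  -- gives `T S`.
  rw [eq_conj_adjoint hn hlam hn3 hST f, star_mul, mul_apply_eq_comp,
    mul_apply_eq_comp, eq_conj_adjoint hn hlam hn3 hT, eq_conj_adjoint hn hlam hn3 hS f,
    conjOp_conjOp]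

/-- The centralizer of the representation is a norm-closed algebra containing the generators, hence
the whole Toeplitz algebra. -/
theorem isCommutativeSubalgebra_toeplitzAlgebra (hn3 : 3 ≤ n) (hlam : (n : ℝ) - 1 < lam) :
    IsCommutativeSubalgebra (toeplitzAlgebra n lam (invariantSymbols n lam (subgroupSOn n))) := by
  have hn : 2 ≤ n := by omega
  have key : ∀ S ∈ toeplitzAlgebra n lam (invariantSymbols n lam (subgroupSOn n)), ∀ g f,
      S (rotOp lam g f) = rotOp lam g (S f) := by
    set U : Set (BergmanSpace n lam →L[ℂ] BergmanSpace n lam) :=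
      Set.range fun g => (rotOp lam g).toContinuousLinearMap with hU
    have hle : toeplitzAlgebra n lam (invariantSymbols n lam (subgroupSOn n)) ≤
        Subalgebra.centralizer ℂ U := by
      refine Subalgebra.topologicalClosure_minimal ?_ (Set.isClosed_centralizer U)
      refine Algebra.adjoin_le ?_
      rintro _ ⟨a, ha, rfl⟩
      rw [SetLike.mem_coe, Subalgebra.mem_centralizer_iff]
      rintro _ ⟨g, rfl⟩
      ext1 f
      exact (toeplitz_rotOp hn hlam ha (Subgroup.mem_top g) f).symm
    intro S hS g f
    have h1 := (Subalgebra.mem_centralizer_iff ℂ).1 (hle hS) _ ⟨g, rfl⟩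
    exact (congrArg (fun T : BergmanSpace n lam →L[ℂ] BergmanSpace n lam => T f) h1).symm
  intro S hS T hT
  exact mul_comm_of_commute_rotOp hn hlam hn3 (key S hS) (key T hT)

/-! ### Commuting operators on a finite-dimensional space -/

/-- A commuting family of operators on a finite-dimensional space is reducible. -/
theorem exists_orthogonal_of_commute {E : Type*} [NormedAddCommGroup E] [InnerProductSpace ℂ E]
    (V : Submodule ℂ E) [FiniteDimensional ℂ V] (F : Set (E →L[ℂ] E))
    (hinv : ∀ T ∈ F, ∀ f ∈ V, T f ∈ V) (hcomm : ∀ S ∈ F, ∀ T ∈ F, S * T = T * S)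
    (hV : ∀ e ∈ V, ∃ e' ∈ V, e' ≠ 0 ∧ ⟪e', e⟫_ℂ = 0) :
    ∃ e₁ ∈ V, e₁ ≠ 0 ∧ ∃ e₂ ∈ V, e₂ ≠ 0 ∧ ∀ T ∈ F, ⟪e₂, T e₁⟫_ℂ = 0 := by
  obtain ⟨q, hqV, hq0, -⟩ := hV 0 V.zero_mem
  -- If every operator is scalar on `V`, any orthogonal pair of nonzero vectors works.
  by_cases hsc : ∀ T ∈ F, ∃ μ : ℂ, ∀ f ∈ V, T f = μ • f
  · obtain ⟨e, heV, he0, he⟩ := hV q hqV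
    refine ⟨q, hqV, hq0, e, heV, he0, fun T hT => ?_⟩
    obtain ⟨μ, hμ⟩ := hsc T hT
    rw [hμ q hqV, inner_smul_right, he, mul_zero]
  push Not at hsc
  obtain ⟨T, hT, hns⟩ := hsc
  set TV : Module.End ℂ V := T.toLinearMap.restrict (hinv T hT) with hTV
  have : Nontrivial V := ⟨⟨q, hqV⟩, 0, by simpa [Subtype.ext_iff] using hq0⟩
  obtain ⟨μ, hμ⟩ := Module.End.exists_eigenvalue TV
  obtain ⟨v, hv⟩ := hμ.exists_hasEigenvector
  obtain ⟨f, hfV, hf⟩ := hns μ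
  -- An eigenspace of a nonscalar `T` in `V` is a proper subspace, invariant under everything
  -- commuting with `T`. The component of `f` orthogonal to it is nonzero, since `f` is not in the
  -- eigenspace.
  set W : Submodule ℂ E := V ⊓ LinearMap.ker (T.toLinearMap - μ • LinearMap.id) with hW
  have hWmem : ∀ x, x ∈ W ↔ x ∈ V ∧ T x = μ • x := fun x => by
    simp [hW, sub_eq_zero]
  have : FiniteDimensional ℂ W :=
    Submodule.finiteDimensional_of_le (inf_le_left : W ≤ V)
  have hvW : (v : E) ∈ W := (hWmem _).2 ⟨v.2, by
    have := hv.apply_eq_smul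
    exact congrArg Subtype.val this⟩
  refine ⟨v, v.2, fun h => hv.2 (Subtype.ext h), f - W.starProjection f, ?_, ?_, ?_⟩
  · exact V.sub_mem hfV ((hWmem _).1 (W.starProjection_apply_mem f)).1
  · intro h0
    rw [sub_eq_zero] at h0
    exact hf ((hWmem f).1 (h0 ▸ W.starProjection_apply_mem f)).2
  · intro S hS
    have hSv : S v ∈ W := by
      refine (hWmem _).2 ⟨hinv S hS _ v.2, ?_⟩
      have h1 := congrArg (fun A : E →L[ℂ] E => A v) (hcomm T hT S hS)
      simp only [mul_apply_eq_comp] at h1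
      rw [h1, ((hWmem _).1 hvW).2, map_smul]
    exact (Submodule.mem_orthogonal' W _).1 (W.sub_starProjection_mem_orthogonal f) _ hSv

/-! ### Holomorphic functions of degree two -/

/-- The elements of the Bergman space on which `H` acts by the character `(A, t) ↦ t⁻²`. -/
def quadSpace (lam : ℝ) (H : Subgroup (K n)) : Submodule ℂ (BergmanSpace n lam) where
  carrier := {f | ∀ g ∈ H, rotOp lam g f = ((g.2⁻¹ : Circle) : ℂ) ^ 2 • f}
  zero_mem' := fun g _ => by simp
  add_mem' := fun {f h} hf hh g hg => by rw [map_add, hf g hg, hh g hg, smul_add]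
  smul_mem' := fun c f hf g hg => by rw [map_smul, hf g hg, smul_comm]

theorem holo_act_inv_of_mem_quadSpace (hn : 2 ≤ n) (hlam : (n : ℝ) - 1 < lam) {H : Subgroup (K n)}
    {f : BergmanSpace n lam} (hf : f ∈ quadSpace lam H) {g : K n} (hg : g ∈ H) {z : Fin n → ℂ}
    (hz : z ∈ domain n) : holo f (act g⁻¹ z) = ((g.2⁻¹ : Circle) : ℂ) ^ 2 * holo f z := by
  have h1 := holo_rotOp hn hlam g f hz
  rw [hf g hg, holo_smul hn hlam _ _ hz] at h1
  exact h1.symm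

/-- For `|c| = 1` this is the action of `SO(2)`. Both sides are holomorphic in `c` up to the
boundary of the unit disc, so agreement on the circle propagates inside. -/
theorem holo_smul_of_mem_quadSpace (hn : 2 ≤ n) (hlam : (n : ℝ) - 1 < lam) {H : Subgroup (K n)}
    (hH : ∀ t : Circle, ((1, t) : K n) ∈ H) {f : BergmanSpace n lam} (hf : f ∈ quadSpace lam H)
    {z : Fin n → ℂ} (hz : z ∈ domain n) {c : ℂ} (hc : ‖c‖ ≤ 1) :
    holo f (c • z) = c ^ 2 * holo f z := by
  have h1 : DiffContOnCl ℂ (fun c : ℂ => holo f (c • z)) (Metric.ball 0 1) := by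
    apply DifferentiableOn.diffContOnCl
    rw [closure_ball (0 : ℂ) one_ne_zero]
    exact (differentiableOn_holo f).comp (by fun_prop) fun c hc =>
      smul_mem_domain hz (by simpa using hc)
  have h2 : DiffContOnCl ℂ (fun c : ℂ => c ^ 2 * holo f z) (Metric.ball 0 1) :=
    Differentiable.diffContOnCl (by fun_prop)
  have h3 := Complex.eqOn_closure_of_eqOn_frontier Metric.isBounded_ball h1 h2 ?_
  · rw [closure_ball (0 : ℂ) one_ne_zero] at h3
    exact h3 (by simpa using hc)
  · rw [frontier_ball (0 : ℂ) one_ne_zero]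
    intro c hc
    have hc1 : ‖c‖ = 1 := by simpa using hc
    obtain ⟨t, rfl⟩ : ∃ t : Circle, (t : ℂ) = c := ⟨⟨c, mem_sphere_zero_iff_norm.2 hc1⟩, rfl⟩
    have h4 := holo_act_inv_of_mem_quadSpace hn hlam hf (hH t⁻¹) hz
    have h5 : ((1, t⁻¹) : K n)⁻¹ = (1, t) := by simp
    rw [h5, inv_inv] at h4
    simpa [act] using h4

/-- An element of `quadSpace` is controlled by its values near the origin. -/
theorem norm_holo_le_of_mem_quadSpace (hn : 2 ≤ n) (hlam : (n : ℝ) - 1 < lam) {H : Subgroup (K n)}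
    (hH : ∀ t : Circle, ((1, t) : K n) ∈ H) {f : BergmanSpace n lam} (hf : f ∈ quadSpace lam H)
    {ε M : ℝ} (hε : 0 < ε) (hε1 : ε ≤ 1)
    (hM : ∀ z ∈ Metric.closedBall (0 : Fin n → ℂ) ε, z ∈ domain n → ‖holo f z‖ ≤ M)
    {z : Fin n → ℂ} (hz : z ∈ domain n) : ‖holo f z‖ ≤ M / ε ^ 2 := by
  have hεn : ‖(ε : ℂ)‖ = ε := by rw [Complex.norm_real, Real.norm_of_nonneg hε.le]
  have h1 := holo_smul_of_mem_quadSpace hn hlam hH hf hz (c := ε) (by rw [hεn]; exact hε1)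
  have h2 := hM ((ε : ℂ) • z) (by
    rw [mem_closedBall_zero_iff, norm_smul, hεn]
    nlinarith [norm_le_one_of_mem_domain hz]) (smul_mem_domain hz (by rw [hεn]; exact hε1))
  rw [h1, norm_mul, norm_pow, hεn] at h2
  rw [le_div_iff₀ (by positivity), mul_comm]
  exact h2

theorem norm_le_of_norm_holo_le (hn : 2 ≤ n) (hlam : (n : ℝ) - 1 < lam) {f : BergmanSpace n lam}
    {M : ℝ} (hM : 0 ≤ M) (h : ∀ z ∈ domain n, ‖holo f z‖ ≤ M) : ‖f‖ ≤ M := by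
  have := isProbabilityMeasure_vMeasure hn hlam
  rw [← (bergmanIncl n lam).norm_map]
  have := Lp.norm_le_of_ae_bound (f := bergmanIncl n lam f) hM (by
    filter_upwards [incl_ae_eq_holo f, ae_mem_domain n lam] with z h1 h2
    rw [h1]
    exact h z h2)
  simpa [measureUnivNNReal] using this

/-- Evaluation on a fine finite net in a small ball is injective: an `f` vanishing on the net is at
most `L δ ‖f‖` on that ball by the Schwarz lemma, hence at most `(L δ / ε²) ‖f‖` on the whole domain
by homogeneity. So `‖f‖ ≤ ‖f‖ / 2`. -/
theorem finiteDimensional_quadSpace (hn : 2 ≤ n) (hlam : (n : ℝ) - 1 < lam) {H : Subgroup (K n)}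
    (hH : ∀ t : Circle, ((1, t) : K n) ∈ H) : FiniteDimensional ℂ (quadSpace lam H) := by
  obtain ⟨R, C, hR, hC, hsub, hb⟩ := exists_norm_holo_le hn hlam (zero_mem_domain n)
  set ε := min (R / 2) 1 with hεdef
  have hε : 0 < ε := lt_min (by positivity) one_pos
  have hεR : ε ≤ R / 2 := min_le_left _ _
  have hε1 : ε ≤ 1 := min_le_right _ _
  set L : ℝ := 2 * C / (R / 2) with hL
  have hL0 : 0 ≤ L := by positivity
  -- The mesh is chosen to make the contraction factor `L δ / ε²` at most `1 / 2`.
  set δ := min (R / 2) (ε ^ 2 / (2 * (L + 1))) with hδdef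
  have hδ : 0 < δ := lt_min (by positivity) (by positivity)
  have hδL : L * δ / ε ^ 2 ≤ 1 / 2 := by
    have h1 : δ ≤ ε ^ 2 / (2 * (L + 1)) := min_le_right _ _
    rw [le_div_iff₀ (by positivity)] at h1
    rw [div_le_div_iff₀ (by positivity) two_pos]
    nlinarith
  obtain ⟨t, hts, htf, hcov⟩ := (isCompact_closedBall (0 : Fin n → ℂ) ε).finite_cover_balls hδ
  have hsubε : Metric.closedBall (0 : Fin n → ℂ) ε ⊆ domain n :=
    (Metric.closedBall_subset_closedBall (by linarith)).trans hsub
  have := htf.fintype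
  set ev : quadSpace lam H →ₗ[ℂ] (t → ℂ) :=
    { toFun := fun f x => holo (f : BergmanSpace n lam) x
      map_add' := fun f g => funext fun x => holo_add hn hlam _ _ (hsubε (hts x.2))
      map_smul' := fun c f => funext fun x => holo_smul hn hlam _ _ (hsubε (hts x.2)) } with hev
  refine FiniteDimensional.of_injective ev ((injective_iff_map_eq_zero ev).2 ?_)
  intro f hf
  set f' : BergmanSpace n lam := f.1
  have hbound : ∀ z ∈ Metric.closedBall (0 : Fin n → ℂ) ε, z ∈ domain n →
      ‖holo f' z‖ ≤ L * δ * ‖f'‖ := by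
    intro z hz _
    obtain ⟨x, hx, hzx⟩ := Set.mem_iUnion₂.1 (hcov hz)
    have hfx : holo f' x = 0 := congrFun hf ⟨x, hx⟩
    have hxε := hts hx
    have hballsub : Metric.ball x (R / 2) ⊆ Metric.closedBall 0 R := by
      refine Metric.ball_subset_closedBall.trans (Metric.closedBall_subset_closedBall' ?_)
      have := Metric.mem_closedBall.1 hxε
      linarith
    have hzx' : z ∈ Metric.ball x (R / 2) := Metric.ball_subset_ball (min_le_left _ _) hzx
    have h1 := Complex.dist_le_div_mul_dist_of_mapsTo_ball (f := holo f') (c := x) (R₁ := R / 2)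
      (R₂ := 2 * C * ‖f'‖) ((differentiableOn_holo f').mono (hballsub.trans hsub)) (by
        intro w hw
        rw [hfx, mem_closedBall_zero_iff]
        have := hb f' w (hballsub hw)
        nlinarith [mul_nonneg hC (norm_nonneg f')]) hzx'
    rw [hfx, dist_zero_right] at h1
    have h2 : dist z x ≤ δ := (Metric.mem_ball.1 hzx).le
    calc ‖holo f' z‖ ≤ 2 * C * ‖f'‖ / (R / 2) * dist z x := h1
      _ = L * dist z x * ‖f'‖ := by rw [hL]; ring
      _ ≤ L * δ * ‖f'‖ := by gcongr
  have h1 : ‖f'‖ ≤ L * δ * ‖f'‖ / ε ^ 2 :=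
    norm_le_of_norm_holo_le hn hlam (by positivity) fun z hz =>
      norm_holo_le_of_mem_quadSpace hn hlam hH f.2 hε hε1 hbound hz
  have h2 : L * δ * ‖f'‖ / ε ^ 2 = L * δ / ε ^ 2 * ‖f'‖ := by ring
  rw [h2] at h1
  have h3 : ‖f'‖ = 0 := by nlinarith [norm_nonneg f']
  exact Subtype.ext (norm_eq_zero.1 h3)

/-- Homogeneity spreads the evaluation bound near the origin over the domain. Boundedness is what
makes `conj f * h` an admissible symbol. -/
theorem exists_norm_holo_le_of_mem_quadSpace (hn : 2 ≤ n) (hlam : (n : ℝ) - 1 < lam)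
    {H : Subgroup (K n)} (hH : ∀ t : Circle, ((1, t) : K n) ∈ H) {f : BergmanSpace n lam}
    (hf : f ∈ quadSpace lam H) : ∃ M : ℝ, ∀ z ∈ domain n, ‖holo f z‖ ≤ M := by
  obtain ⟨R, C, hR, hC, hsub, hb⟩ := exists_norm_holo_le hn hlam (zero_mem_domain n)
  refine ⟨C * ‖f‖ / (min R 1) ^ 2, fun z hz =>
    norm_holo_le_of_mem_quadSpace hn hlam hH hf (lt_min hR one_pos) (min_le_right _ _) ?_ hz⟩
  exact fun z hz _ => hb f z (Metric.closedBall_subset_closedBall (min_le_left _ _) hz)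

/-- In `quadSpace` there are no zero divisors. -/
theorem eq_zero_of_holo_mul_eq_zero (hn : 2 ≤ n) (hlam : (n : ℝ) - 1 < lam) {H : Subgroup (K n)}
    (hH : ∀ t : Circle, ((1, t) : K n) ∈ H) {f h : BergmanSpace n lam} (hf : f ∈ quadSpace lam H)
    (hf0 : f ≠ 0) (hfh : ∀ z ∈ domain n, holo f z * holo h z = 0) : h = 0 := by
  have hzero : ∀ z ∈ domain n, holo (0 : BergmanSpace n lam) z = 0 := by
    intro z hz
    have := holo_smul hn hlam 0 (0 : BergmanSpace n lam) hz
    simpa using this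
  obtain ⟨p, hp, hfp⟩ : ∃ p ∈ domain n, holo f p ≠ 0 := by
    by_contra! hall
    exact hf0 (eq_of_holo_eqOn fun z hz => by rw [hall z hz, hzero z hz])
  obtain ⟨r, hr, hball⟩ := Metric.isOpen_iff.1 (isOpen_domain n) 0 (zero_mem_domain n)
  -- Homogeneity moves a nonzero value of `f` to a point `p'` in a ball about the origin, where
  -- lines from `p'` can be used by convexity.
  set ε : ℝ := min (r / 2) 1 with hεdef
  have hε : 0 < ε := lt_min (by positivity) one_pos
  have hεn : ‖(ε : ℂ)‖ = ε := by rw [Complex.norm_real, Real.norm_of_nonneg hε.le]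
  have hε1 : ‖(ε : ℂ)‖ ≤ 1 := by rw [hεn]; exact min_le_right _ _
  set p' : Fin n → ℂ := (ε : ℂ) • p with hp'
  have hp'D : p' ∈ domain n := smul_mem_domain hp hε1
  have hp'b : p' ∈ Metric.ball (0 : Fin n → ℂ) r := by
    rw [mem_ball_zero_iff, hp', norm_smul, hεn]
    have h1 := norm_le_one_of_mem_domain hp
    have h2 : ε ≤ r / 2 := min_le_left _ _
    nlinarith [norm_nonneg p]
  have hfp' : holo f p' ≠ 0 := by
    rw [hp', holo_smul_of_mem_quadSpace hn hlam hH hf hp hε1]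
    exact mul_ne_zero (pow_ne_zero 2 (Complex.ofReal_ne_zero.2 hε.ne')) hfp
  have hev : ∀ᶠ z in nhds p', holo h z = 0 := by
    have hD := (isOpen_domain n).mem_nhds hp'D
    filter_upwards [((differentiableOn_holo f).continuousOn.continuousAt hD).eventually_ne hfp',
      hD] with z h1 h2
    exact (mul_eq_zero.1 (hfh z h2)).resolve_left h1
  apply eq_of_holo_eventuallyEq
  filter_upwards [Metric.ball_mem_nhds (0 : Fin n → ℂ) hr] with z hz
  rw [hzero z (hball hz)]
  -- `h` vanishes near `p'`; the identity theorem along the complex line through `p'` and `z`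
  -- carries this to `z`.
  set U : Set ℂ := {s : ℂ | p' + s • (z - p') ∈ Metric.ball (0 : Fin n → ℂ) r} with hU
  have hUo : IsOpen U := Metric.isOpen_ball.preimage (by fun_prop)
  have hUc : Convex ℝ U := by
    have h1 : Convex ℝ (Metric.ball (0 : Fin n → ℂ) r) := convex_ball 0 r
    intro s hs s' hs' α β hα hβ hαβ
    have h2 := h1 hs hs' hα hβ hαβ
    change p' + (α • s + β • s') • (z - p') ∈ Metric.ball (0 : Fin n → ℂ) r
    convert h2 using 1
    have hβ' : β = 1 - α := by linarith
    rw [hβ']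
    ext i
    simp
    ring
  have hd : AnalyticOnNhd ℂ (fun s : ℂ => holo h (p' + s • (z - p'))) U := by
    refine DifferentiableOn.analyticOnNhd ?_ hUo
    exact (differentiableOn_holo h).comp (by fun_prop) fun s hs => hball hs
  have hev' : (fun s : ℂ => holo h (p' + s • (z - p'))) =ᶠ[nhds 0] 0 := by
    have ht : Filter.Tendsto (fun s : ℂ => p' + s • (z - p')) (nhds 0) (nhds p') := by
      have : Continuous fun s : ℂ => p' + s • (z - p') := by fun_prop
      simpa using this.tendsto 0
    exact ht.eventually hev
  have h1 := hd.eqOn_zero_of_preconnected_of_eventuallyEq_zero hUc.isPreconnected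
    (show (0 : ℂ) ∈ U by simpa [hU] using hp'b) hev' (show (1 : ℂ) ∈ U by simpa [hU] using hz)
  simpa using h1

/-! ### Partial sums of squares -/

/-- `∑ i ∈ I, z i ^ 2`. -/
def sumSq (I : Finset (Fin n)) (z : Fin n → ℂ) : ℂ := ∑ i ∈ I, z i ^ 2

theorem differentiable_sumSq (I : Finset (Fin n)) : Differentiable ℂ (sumSq I) := by
  unfold sumSq
  fun_prop

theorem norm_sumSq_le (I : Finset (Fin n)) {z : Fin n → ℂ} (hz : z ∈ domain n) :
    ‖sumSq I z‖ ≤ 1 := by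
  refine (norm_sum_le _ _).trans (le_trans ?_ hz.1.le)
  simp only [norm_pow]
  exact Finset.sum_le_sum_of_subset_of_nonneg (Finset.subset_univ I) fun _ _ _ => by positivity

theorem memLp_sumSq (hn : 2 ≤ n) (hlam : (n : ℝ) - 1 < lam) (I : Finset (Fin n)) :
    MemLp (sumSq I) 2 (vMeasure n lam) := by
  have := isProbabilityMeasure_vMeasure hn hlam
  refine MemLp.of_bound (differentiable_sumSq I).continuous.aestronglyMeasurable 1 ?_
  filter_upwards [ae_mem_domain n lam] with z hz
  exact norm_sumSq_le I hz

theorem exists_mem_quadSpace_holo_eq_sumSq (hn : 2 ≤ n) (hlam : (n : ℝ) - 1 < lam)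
    {H : Subgroup (K n)} (I : Finset (Fin n))
    (hI : ∀ g ∈ H, ∀ z, sumSq I (act g z) = (g.2 : ℂ) ^ 2 * sumSq I z) :
    ∃ f ∈ quadSpace lam H, Set.EqOn (holo f) (sumSq I) (domain n) := by
  have h := holo_mkBergman hn hlam (sumSq I) (differentiable_sumSq I).differentiableOn
    (memLp_sumSq hn hlam I)
  refine ⟨_, fun g hg => eq_of_holo_eqOn fun z hz => ?_, h⟩
  rw [holo_rotOp hn hlam g _ hz, Function.comp_apply, h (act_mem_domain _ hz),
    hI _ (H.inv_mem hg), holo_smul hn hlam _ _ hz, Pi.smul_apply, h hz]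
  rfl

theorem sumSq_univ_act (g : K n) (z : Fin n → ℂ) :
    sumSq Finset.univ (act g z) = (g.2 : ℂ) ^ 2 * sumSq Finset.univ z := by
  have h := dotProduct_act g z
  simp only [dotProduct, ← sq] at h
  exact h

theorem sumSq_single (I : Finset (Fin n)) (c : ℂ) (j : Fin n) :
    sumSq I (Pi.single j c) = if j ∈ I then c ^ 2 else 0 := by
  simp [sumSq, Pi.single_apply, ite_pow]

theorem single_mem_domain (j : Fin n) : (Pi.single j (1 / 2) : Fin n → ℂ) ∈ domain n := by
  have h1 : ∑ i, ‖(Pi.single j (1 / 2) : Fin n → ℂ) i‖ ^ 2 = 1 / 4 := by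
    rw [Finset.sum_eq_single j]
    · simp
      norm_num
    · intro i _ hij
      simp [Pi.single_eq_of_ne hij]
    · simp
  constructor
  · rw [h1]; norm_num
  · rw [h1]
    nlinarith [sq_nonneg ‖(Pi.single j (1 / 2) : Fin n → ℂ) ⬝ᵥ Pi.single j (1 / 2)‖]

/-- `quadSpace` has dimension at least two. Otherwise the full and the partial sum of squares would
be multiples of one vector, which their values at half the basis vectors `i ∈ I` and `j ∉ I`
exclude. -/
theorem exists_mem_quadSpace_orthogonal (hn : 2 ≤ n) (hlam : (n : ℝ) - 1 < lam)
    {H : Subgroup (K n)} {I : Finset (Fin n)} {i j : Fin n} (hi : i ∈ I) (hj : j ∉ I)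
    (hI : ∀ g ∈ H, ∀ z, sumSq I (act g z) = (g.2 : ℂ) ^ 2 * sumSq I z)
    (e : BergmanSpace n lam) (he : e ∈ quadSpace lam H) :
    ∃ e' ∈ quadSpace lam H, e' ≠ 0 ∧ ⟪e', e⟫_ℂ = 0 := by
  obtain ⟨p, hpV, hp⟩ := exists_mem_quadSpace_holo_eq_sumSq hn hlam Finset.univ
    (H := H) fun g _ z => sumSq_univ_act g z
  obtain ⟨q, hqV, hq⟩ := exists_mem_quadSpace_holo_eq_sumSq hn hlam I hI
  by_contra! hno
  have key : ∀ f ∈ quadSpace lam H, ∃ c : ℂ, f = c • e := by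
    intro f hf
    refine ⟨⟪e, f⟫_ℂ / ⟪e, e⟫_ℂ, ?_⟩
    by_contra hne
    refine hno (f - (⟪e, f⟫_ℂ / ⟪e, e⟫_ℂ) • e)
      (Submodule.sub_mem _ hf (Submodule.smul_mem _ _ he)) (sub_ne_zero.2 hne) ?_
    rw [← inner_conj_symm, inner_sub_right, inner_smul_right]
    by_cases h0 : e = 0
    · simp [h0]
    · rw [div_mul_cancel₀ _ (inner_self_ne_zero.2 h0), sub_self, map_zero]
  obtain ⟨c, rfl⟩ := key p hpV
  obtain ⟨d, rfl⟩ := key q hqV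
  have hev : ∀ l : Fin n, c * holo e (Pi.single l (1 / 2)) = 1 / 4 ∧
      d * holo e (Pi.single l (1 / 2)) = if l ∈ I then 1 / 4 else 0 := by
    intro l
    have hl := single_mem_domain l
    have h1 := hp hl
    have h2 := hq hl
    rw [holo_smul hn hlam _ _ hl, sumSq_single] at h1 h2
    norm_num at h1 h2
    norm_num
    exact ⟨h1, h2⟩
  have h1 := (hev j).1
  have h2 := (hev j).2
  have h3 := (hev i).2
  rw [if_neg hj] at h2
  rw [if_pos hi] at h3
  rcases mul_eq_zero.1 h2 with h | h
  · rw [h, zero_mul] at h3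
    norm_num at h3
  · rw [h, mul_zero] at h1
    norm_num at h1

/-! ### Non-commutativity -/

theorem toeplitz_mem_toeplitzAlgebra {S : Set (Lp ℂ ∞ (vMeasure n lam))}
    {a : Lp ℂ ∞ (vMeasure n lam)} (ha : a ∈ S) : toeplitz n lam a ∈ toeplitzAlgebra n lam S :=
  Subalgebra.le_topologicalClosure _ (Algebra.subset_adjoin ⟨a, ha, rfl⟩)

/-- For `f, h` in `quadSpace`, the symbol `conj f * h` is invariant. -/
theorem exists_invariantSymbol (hn : 2 ≤ n) (hlam : (n : ℝ) - 1 < lam) {H : Subgroup (K n)}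
    (hH : ∀ t : Circle, ((1, t) : K n) ∈ H) {f h : BergmanSpace n lam}
    (hf : f ∈ quadSpace lam H) (hh : h ∈ quadSpace lam H) :
    ∃ a ∈ invariantSymbols n lam H,
      a =ᵐ[vMeasure n lam] fun z => star (holo f z) * holo h z := by
  obtain ⟨M, hM⟩ := exists_norm_holo_le_of_mem_quadSpace hn hlam hH hf
  obtain ⟨N, hN⟩ := exists_norm_holo_le_of_mem_quadSpace hn hlam hH hh
  have hL : MemLp (fun z => star (holo f z) * holo h z) ∞ (vMeasure n lam) := by
    refine memLp_top_of_bound ((memLp_holo f).star.1.mul (memLp_holo h).1) (M * N) ?_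
    filter_upwards [ae_mem_domain n lam] with z hz
    rw [norm_mul, norm_star]
    exact mul_le_mul (hM z hz) (hN z hz) (norm_nonneg _) ((norm_nonneg _).trans (hM z hz))
  refine ⟨hL.toLp _, fun g hg => ?_, hL.coeFn_toLp⟩
  filter_upwards [hL.coeFn_toLp,
    (measurePreserving_act lam g⁻¹).quasiMeasurePreserving.ae hL.coeFn_toLp,
    ae_mem_domain n lam] with z h1 h2 hz
  rw [h1, h2, holo_act_inv_of_mem_quadSpace hn hlam hf hg hz,
    holo_act_inv_of_mem_quadSpace hn hlam hh hg hz]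
  -- The characters of `conj f` and `h` are inverse to each other, so the product is invariant.
  have ht : star (((g.2⁻¹ : Circle) : ℂ) ^ 2) * ((g.2⁻¹ : Circle) : ℂ) ^ 2 = 1 := by
    have hn1 : ‖((g.2⁻¹ : Circle) : ℂ)‖ = 1 := Circle.norm_coe _
    change (starRingEnd ℂ) _ * _ = 1
    rw [Complex.conj_mul', norm_pow, hn1]
    simp
  rw [star_mul']
  linear_combination (star (holo f z) * holo h z) * ht

/-- The integrand is `|f h|²`, so `f h` vanishes almost everywhere and, by continuity, on the
domain. -/
theorem holo_mul_eq_zero_of_integral (hn : 2 ≤ n) (hlam : (n : ℝ) - 1 < lam)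
    {f h : BergmanSpace n lam} {M N : ℝ} (hM : ∀ z ∈ domain n, ‖holo f z‖ ≤ M)
    (hN : ∀ z ∈ domain n, ‖holo h z‖ ≤ N)
    (h0 : ∫ z, star (holo f z) * holo h z * holo f z * star (holo h z) ∂vMeasure n lam = 0) :
    ∀ z ∈ domain n, holo f z * holo h z = 0 := by
  have := isProbabilityMeasure_vMeasure hn hlam
  have h1 : ∀ z, star (holo f z) * holo h z * holo f z * star (holo h z) =
      ((‖holo f z * holo h z‖ ^ 2 : ℝ) : ℂ) := by
    intro z
    have := Complex.mul_conj' (holo f z * holo h z)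
    rw [Complex.ofReal_pow, ← this, map_mul]
    change _ = holo f z * holo h z * (star (holo f z) * star (holo h z))
    ring
  have hm : AEStronglyMeasurable (fun z => holo f z * holo h z) (vMeasure n lam) :=
    (memLp_holo f).1.mul (memLp_holo h).1
  have hint : Integrable (fun z => ‖holo f z * holo h z‖ ^ 2) (vMeasure n lam) := by
    refine Integrable.of_bound (hm.norm.pow 2) ((M * N) ^ 2) ?_
    filter_upwards [ae_mem_domain n lam] with z hz
    rw [norm_pow, norm_norm, norm_mul]
    have : ‖holo f z‖ * ‖holo h z‖ ≤ M * N :=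
      mul_le_mul (hM z hz) (hN z hz) (norm_nonneg _) ((norm_nonneg _).trans (hM z hz))
    gcongr
  simp only [h1] at h0
  rw [integral_complex_ofReal, Complex.ofReal_eq_zero,
    integral_eq_zero_iff_of_nonneg (fun z => by positivity) hint] at h0
  have hae : (fun z => holo f z * holo h z) =ᵐ[vMeasure n lam] fun _ => 0 := by
    filter_upwards [h0] with z hz
    simpa using hz
  exact eqOn_domain_of_ae_eq hn hlam ((differentiableOn_holo f).continuousOn.mul
    (differentiableOn_holo h).continuousOn) continuousOn_const hae

/-- If `H` contains `SO(2)` and preserves a proper partial sum of squares, then the Toeplitz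
operators with `H`-invariant symbols do not commute. -/
theorem not_isCommutativeSubalgebra (hn : 2 ≤ n) (hlam : (n : ℝ) - 1 < lam)
    {H : Subgroup (K n)} (hH : ∀ t : Circle, ((1, t) : K n) ∈ H) {I : Finset (Fin n)}
    {i j : Fin n} (hi : i ∈ I) (hj : j ∉ I)
    (hI : ∀ g ∈ H, ∀ z, sumSq I (act g z) = (g.2 : ℂ) ^ 2 * sumSq I z) :
    ¬ IsCommutativeSubalgebra (toeplitzAlgebra n lam (invariantSymbols n lam H)) := by
  intro hcomm
  have := finiteDimensional_quadSpace (lam := lam) hn hlam hH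
  obtain ⟨f, hf, hf0, h, hh, hh0, hT⟩ := exists_orthogonal_of_commute (quadSpace lam H)
    (toeplitz n lam '' invariantSymbols n lam H) (by
      rintro _ ⟨a, ha, rfl⟩ f hf g hg
      rw [← toeplitz_rotOp hn hlam ha hg, hf g hg, map_smul]) (by
      rintro _ ⟨a, ha, rfl⟩ _ ⟨b, hb, rfl⟩
      exact hcomm _ (toeplitz_mem_toeplitzAlgebra ha) _ (toeplitz_mem_toeplitzAlgebra hb))
    (exists_mem_quadSpace_orthogonal hn hlam hi hj hI)
  obtain ⟨M, hM⟩ := exists_norm_holo_le_of_mem_quadSpace hn hlam hH hf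
  obtain ⟨N, hN⟩ := exists_norm_holo_le_of_mem_quadSpace hn hlam hH hh
  -- With `a = conj f * h`, the vanishing coefficient `⟪h, T_a f⟫` is exactly `∫ |f h|²`.
  obtain ⟨a, ha, haf⟩ := exists_invariantSymbol hn hlam hH hf hh
  have h0 := hT _ ⟨a, ha, rfl⟩
  rw [inner_toeplitz] at h0
  refine hh0 (eq_zero_of_holo_mul_eq_zero hn hlam hH hf hf0
    (holo_mul_eq_zero_of_integral hn hlam hM hN ?_))
  rw [← h0]
  apply integral_congr_ae
  filter_upwards [haf] with z hz
  rw [hz]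

/-! ### The three subgroups -/

theorem sumSq_act {g : K n} {I : Finset (Fin n)}
    (hI : ∀ z : Fin n → ℂ, sumSq I (g.1.1.map ((↑) : ℝ → ℂ) *ᵥ z) = sumSq I z)
    (z : Fin n → ℂ) : sumSq I (act g z) = (g.2 : ℂ) ^ 2 * sumSq I z := by
  rw [← hI z, sumSq, sumSq, Finset.mul_sum]
  simp [act, mul_pow]

theorem reindex_map_mulVec {ι κ : Type*} [Fintype ι] [Fintype κ] (e : ι ≃ κ) (A : Matrix ι ι ℝ)
    (z : κ → ℂ) (i : ι) :
    ((Matrix.reindex e e A).map ((↑) : ℝ → ℂ) *ᵥ z) (e i) = ∑ j, (A i j : ℂ) * z (e j) := by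
  simp only [mulVec, dotProduct]
  rw [← e.sum_comp]
  simp

/-- The upper left corner fixes the last coordinate, whose square is the invariant partial sum. -/
theorem not_isCommutativeSubalgebra_corner (hn : 3 ≤ n) (hlam : (n : ℝ) - 1 < lam) :
    ¬ IsCommutativeSubalgebra
      (toeplitzAlgebra n lam (invariantSymbols n lam (subgroupCorner n))) := by
  obtain ⟨m, rfl⟩ := Nat.exists_eq_add_of_le' (show 1 ≤ n by omega)
  set l : Fin (m + 1) := finSumFinEquiv (Sum.inr 0) with hl
  have : Nontrivial (Fin (m + 1)) := Fin.nontrivial_iff_two_le.2 (by omega)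
  obtain ⟨j, hj⟩ := exists_ne l
  refine not_isCommutativeSubalgebra (by omega) hlam (I := {l}) (i := l) (j := j)
    (fun t => ⟨one_mem _, Subgroup.mem_top _⟩) (Finset.mem_singleton_self l) (by simpa using hj) ?_
  rintro g ⟨⟨B, hB⟩, -⟩
  refine sumSq_act fun z => ?_
  rw [← hB]
  simp only [sumSq, Finset.sum_singleton]
  congr 1
  change ((cornerMatrix B.1).map ((↑) : ℝ → ℂ) *ᵥ z) l = z l
  rw [cornerMatrix, hl, reindex_map_mulVec]
  simp

/-- The first rotation block preserves the sum of squares of its two coordinates, a proper partial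
sum because `n ≥ 3`. -/
theorem not_isCommutativeSubalgebra_torus (hn : 3 ≤ n) (hlam : (n : ℝ) - 1 < lam) :
    ¬ IsCommutativeSubalgebra
      (toeplitzAlgebra n lam (invariantSymbols n lam (subgroupTorus n))) := by
  set j₀ : Fin (n / 2) := ⟨0, by omega⟩
  set p : Fin n := torusIndex n (Sum.inl (0, j₀)) with hp
  set q : Fin n := torusIndex n (Sum.inl (1, j₀)) with hq
  have hpq : p ≠ q := by simp [hp, hq]
  obtain ⟨j, hj⟩ : ∃ j, j ∉ ({p, q} : Finset (Fin n)) := by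
    by_contra! hall
    have h1 : (Finset.univ : Finset (Fin n)) ⊆ {p, q} := fun x _ => hall x
    have h2 := (Finset.card_le_card h1).trans Finset.card_le_two
    rw [Finset.card_univ, Fintype.card_fin] at h2
    omega
  refine not_isCommutativeSubalgebra (by omega) hlam (I := {p, q}) (i := p) (j := j)
    (fun t => ⟨one_mem _, Subgroup.mem_top _⟩) (by simp) hj ?_
  rintro g ⟨⟨θ, hθ⟩, -⟩
  refine sumSq_act fun z => ?_
  rw [← hθ]
  change sumSq {p, q} ((torusMatrix n θ.toAdd).map ((↑) : ℝ → ℂ) *ᵥ z) = _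
  generalize θ.toAdd = θ
  simp only [sumSq, Finset.sum_pair hpq]
  have hrow : ∀ a : Fin 2, ((torusMatrix n θ).map ((↑) : ℝ → ℂ) *ᵥ z)
      (torusIndex n (Sum.inl (a, j₀))) =
        (rot (θ j₀) a 0 : ℂ) * z p + (rot (θ j₀) a 1 : ℂ) * z q := by
    intro a
    rw [torusMatrix, reindex_map_mulVec, Fintype.sum_sum_type, Fintype.sum_prod_type]
    simp [blockDiagonal_apply, Fin.sum_univ_two, apply_ite, ite_mul, hp, hq]
  rw [hrow, hrow]
  have hsc : (Real.sin (θ j₀) : ℂ) ^ 2 + (Real.cos (θ j₀) : ℂ) ^ 2 = 1 := by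
    exact_mod_cast Real.sin_sq_add_cos_sq (θ j₀)
  simp only [rot, of_apply, cons_val_zero, cons_val_one, cons_val', cons_val_fin_one,
    Complex.ofReal_neg]
  linear_combination (z p ^ 2 + z q ^ 2) * hsc

theorem not_isCommutativeSubalgebra_circle (hn : 3 ≤ n) (hlam : (n : ℝ) - 1 < lam) :
    ¬ IsCommutativeSubalgebra
      (toeplitzAlgebra n lam (invariantSymbols n lam (subgroupCircle n))) := by
  refine not_isCommutativeSubalgebra (by omega) hlam (I := {⟨0, by omega⟩}) (i := ⟨0, by omega⟩)
    (j := ⟨1, by omega⟩) (fun t => ⟨one_mem _, Subgroup.mem_top _⟩) (Finset.mem_singleton_self _)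
    (by simp [Fin.ext_iff]) ?_
  rintro g ⟨hg, -⟩
  refine sumSq_act fun z => ?_
  have h1 : g.1 = 1 := hg
  rw [h1]
  have h2 : ((1 : SO n).1.map ((↑) : ℝ → ℂ)) = 1 :=
    Matrix.map_one _ Complex.ofReal_zero Complex.ofReal_one
  rw [h2, one_mulVec]

end CartanIV

end

theorem theorem3p10 (n : ℕ) (hn : 3 ≤ n) (lam : ℝ) (hlam : (n : ℝ) - 1 < lam) :
    (CartanIV.IsCStarSubalgebra (CartanIV.toeplitzAlgebra n lam
        (CartanIV.invariantSymbols n lam (CartanIV.subgroupSOn n))) ∧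
      CartanIV.IsCommutativeSubalgebra (CartanIV.toeplitzAlgebra n lam
        (CartanIV.invariantSymbols n lam (CartanIV.subgroupSOn n)))) ∧
    ∀ H : Subgroup (CartanIV.K n),
      H = CartanIV.subgroupCorner n ∨ H = CartanIV.subgroupTorus n ∨
        H = CartanIV.subgroupCircle n →
      CartanIV.IsCStarSubalgebra (CartanIV.toeplitzAlgebra n lam
          (CartanIV.invariantSymbols n lam H)) ∧
        ¬ CartanIV.IsCommutativeSubalgebra (CartanIV.toeplitzAlgebra n lam
          (CartanIV.invariantSymbols n lam H)) := by
  refine ⟨⟨CartanIV.isCStarSubalgebra_toeplitzAlgebra _,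
    CartanIV.isCommutativeSubalgebra_toeplitzAlgebra hn hlam⟩, fun H hH => ?_⟩
  refine ⟨CartanIV.isCStarSubalgebra_toeplitzAlgebra H, ?_⟩
  rcases hH with rfl | rfl | rfl
  · exact CartanIV.not_isCommutativeSubalgebra_corner hn hlam
  · exact CartanIV.not_isCommutativeSubalgebra_torus hn hlam
  · exact CartanIV.not_isCommutativeSubalgebra_circle hn hlam
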